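/- Let $m,n\ge 0$. For a real normed space $V$ with unit sphere $S$ and a label set $\iota$, let $C_k(\iota)$ be the set of $k$-tuples of distinct labels. Let $\widetilde C_\iota(V)$ be the set of configurations $(x_i)_{i\in\iota}$ of distinct points of $V$ modulo translation and positive scaling, with $\pi_{ij}(x)=\frac{x_i-x_j}{|x_i-x_j|}\in S$ and $s_{ijk}(x)=\frac{|x_i-x_j|}{|x_i-x_k|}\in[0,\infty]$. Let $\widetilde C_\iota[V]$ be the closure of the image of $(\pi_{ij})\times(s_{ijk})$ in $S^{C_2(\iota)}\times[0,\infty]^{C_3(\iota)}$ (points are written $(u_{ij}),(d_{ijk})$), let $\widetilde C_\iota\langle V\rangle$ be the closure of the image of $(\pi_{ij})$ in $S^{C_2(\iota)}$, and let $\widetilde Q:\widetilde C_\iota[V]\to\widetilde C_\iota\langle V\rangle$ be the projection. For $\iota=\{1,\dots,n\}$ write $\widetilde C_n$ and $\widetilde Q_n$. From now on $V=\mathbb R^m$, $S=S^{m-1}$. Let $\lambda_\iota\subseteq\widetilde C_\iota[\mathbb R^m]$ (the collinear points) be the image of the map $S^{m-1}\times\widetilde C_\iota[\mathbb R]\to\widetilde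 C_\iota[\mathbb R^m]$, $(v,x)\mapsto(u_{ij}(x)\,v),(d_{ijk}(x))$. Let $\Sigma_\iota$ be the set of connected components of $\widetilde C_\iota[\mathbb R]$ (these are associahedra, one for each ordering of $\iota$), and let $R_\iota$ be the pushout of $S^{m-1}\times\Sigma_\iota\leftarrow S^{m-1}\times\widetilde C_\iota[\mathbb R]\to\widetilde C_\iota[\mathbb R^m]$, where the left map sends each component of $\widetilde C_\iota[\mathbb R]$ to a point. Let $T$ run over the rooted trees with univalent root, leaves labelled by $\{1,\dots,n\}$ and no bivalent internal vertices; identify an internal vertex with the set of labels of the leaves over it. The tree of a point $x\in\widetilde C_n[\mathbb R^m]$ is the one whose internal vertices are the whole label set (if $n\ge 2$) and the sets $\{i\}\cup\{j: d_{ijk}(x)=0\}$ for those $i\ne k$ for which some such $j$ exists. Let $\widetilde C_T[\mathbb R^m]$ be the closure in $\widetilde C_n[\mathbb R^m]$ of the set of points with tree $T$. For an internal vertex $v$ of $T$ let $E(v)$ be the set of edges going up from $v$; restricting $x$ to one chosen leaf over each edge in $E(v)$ gives $x_v\in\widetilde C_{E(v)}[\mathbb R^m]$, and $x\mapsto(x_v)_v$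 is the standard identification of $\widetilde C_T[\mathbb R^m]$ with $\prod_v\widetilde C_{E(v)}[\mathbb R^m]$. The fat wedge of spaces $X_v$ at subsets $A_v\subseteq X_v$ is the subspace of $\prod_v X_v$ of points having at least one coordinate in $A_v$. Let $\lambda_T\subseteq\widetilde C_T[\mathbb R^m]$ correspond to the fat wedge of the $\widetilde C_{E(v)}[\mathbb R^m]$ at the $\lambda_{E(v)}$; let $L_T$ be the fat wedge of the $R_{E(v)}$ at the images of the $S^{m-1}\times\Sigma_{E(v)}$; and let $q_T:\lambda_T\to L_T$ be induced by the maps $\widetilde C_{E(v)}[\mathbb R^m]\to R_{E(v)}$. Let $\bigcup_T\lambda_T$ be the union in $\widetilde C_n[\mathbb R^m]$, let $\bigcup_T L_T$ be the quotient of $\coprod_T L_T$ by the identifications $q_T(x)\sim q_{T'}(x)$ for $x\in\lambda_T\cap\lambda_{T'}$, and let $\bigcup_T q_T:\bigcup_T\lambda_T\to\bigcup_T L_T$ be the map given by $q_T$ on each $\lambda_T$. **Theorem.** The map $\bigcup_T q_T$ is continuous, and there is a continuous map $\bigcup_T L_T\to\widetilde C_n\langle\mathbb R^m\rangle$ making $$\begin{array}{ccc}\bigcup_T\lambda_T&\hookrightarrow&\widetilde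 C_n[\mathbb R^m]\\ {\scriptstyle\bigcup_T q_T}\downarrow&&\downarrow{\scriptstyle\widetilde Q_n}\\ \bigcup_T L_T&\longrightarrow&\widetilde C_n\langle\mathbb R^m\rangle\end{array}$$ a pushout square of topological spaces. Moreover, $\widetilde Q_n$ is a homotopy equivalence. -/

import Mathlib

open scoped ENNReal Topology

noncomputable section

namespace ConfigSpace

/-! ### Configurations modulo translation and positive scaling -/

section Ambient

variable (V : Type) [NormedAddCommGroup V] [NormedSpace ℝ V] (ι : Type)

/-- The space `C_ι(V)` of configurations in `V` of distinct points labelled by `ι`. -/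
abbrev Conf : Type := {x : ι → V // Function.Injective x}

/-- The unit sphere of `V`. -/
abbrev Sph : Type := Metric.sphere (0 : V) 1

/-- The set `C_2(ι)` of ordered pairs of distinct labels `(p 0, p 1)`. -/
abbrev C2 : Type := Fin 2 ↪ ι

/-- The set `C_3(ι)` of ordered triples of distinct labels `(t 0, t 1, t 2)`. -/
abbrev C3 : Type := Fin 3 ↪ ι

/-- Two configurations are equivalent when they differ by a translation and a positive
scaling. -/
def simSetoid : Setoid (Conf V ι) where
  r x y := ∃ (a : ℝ) (b : V), 0 < a ∧ ∀ i, y.1 i = a • x.1 i + b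
  iseqv :=
    { refl := fun x => ⟨1, 0, one_pos, fun i => by simp⟩
      symm := by
        rintro x y ⟨a, b, ha, h⟩
        refine ⟨a⁻¹, -(a⁻¹ • b), inv_pos.2 ha, fun i => ?_⟩
        rw [h i, smul_add, smul_smul, inv_mul_cancel₀ ha.ne', one_smul]
        abel
      trans := by
        rintro x y z ⟨a, b, ha, h⟩ ⟨a', b', ha', h'⟩
        refine ⟨a' * a, a' • b + b', mul_pos ha' ha, fun i => ?_⟩
        rw [h' i, h i, smul_add, smul_smul, add_assoc] }

/-- `C̃_ι(V)`: configurations modulo translation and positive scaling. -/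
abbrev ConfMod : Type := Quotient (simSetoid V ι)

variable {V ι}

/-- `π_{ij}(x)`: the unit vector in the direction of `x_i - x_j`. -/
def dir (x : Conf V ι) (p : C2 ι) : Sph V :=
  ⟨‖x.1 (p 0) - x.1 (p 1)‖⁻¹ • (x.1 (p 0) - x.1 (p 1)), by
    have h : x.1 (p 0) - x.1 (p 1) ≠ 0 :=
      sub_ne_zero.2 fun h => by simpa using p.injective (x.2 h)
    simp [norm_smul, h]⟩

/-- `s_{ijk}(x) = |x_i - x_j| / |x_i - x_k|`, as an element of `[0, ∞]`. -/
def ratio (x : Conf V ι) (t : C3 ι) : ℝ≥0∞ :=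
  ENNReal.ofReal (‖x.1 (t 0) - x.1 (t 1)‖ / ‖x.1 (t 0) - x.1 (t 2)‖)

theorem sim_sub {x y : Conf V ι} {a : ℝ} {b : V}
    (h : ∀ i, y.1 i = a • x.1 i + b) (i j : ι) :
    y.1 i - y.1 j = a • (x.1 i - x.1 j) := by
  rw [h i, h j, smul_sub]; abel

theorem dir_eq_of_sim (x y : Conf V ι) (h : (simSetoid V ι).r x y) : dir x = dir y := by
  obtain ⟨a, b, ha, h⟩ := h
  funext p
  apply Subtype.ext
  simp only [dir, sim_sub h, norm_smul, Real.norm_eq_abs, abs_of_pos ha, smul_smul, mul_inv]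
  congr 1
  field_simp

theorem ratio_eq_of_sim (x y : Conf V ι) (h : (simSetoid V ι).r x y) :
    ratio x = ratio y := by
  obtain ⟨a, b, ha, h⟩ := h
  funext t
  simp only [ratio, sim_sub h, norm_smul, Real.norm_eq_abs, abs_of_pos ha]
  rw [mul_div_mul_left _ _ ha.ne']

/-- The map `(π̃_{ij})` on `C̃_ι(V)`. -/
def dirMod : ConfMod V ι → (C2 ι → Sph V) := Quotient.lift dir dir_eq_of_sim

/-- The map `(s̃_{ijk})` on `C̃_ι(V)`. -/
def ratioMod : ConfMod V ι → (C3 ι → ℝ≥0∞) := Quotient.lift ratio ratio_eq_of_sim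

variable (V ι)

/-- The canonical compactification `C̃_ι[V]`: the closure of the image of `C̃_ι(V)` under
`(π̃_{ij}) × (s̃_{ijk})` in `S^{C_2(ι)} × [0, ∞]^{C_3(ι)}`. -/
def cbarSet : Set ((C2 ι → Sph V) × (C3 ι → ℝ≥0∞)) :=
  closure (Set.range fun c : ConfMod V ι => (dirMod c, ratioMod c))

abbrev CBar : Type := cbarSet V ι

/-- The simplicial compactification `C̃_ι⟨V⟩`: the closure of the image of `C̃_ι(V)` under
`(π̃_{ij})` in `S^{C_2(ι)}`. -/
def cangleSet : Set (C2 ι → Sph V) :=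
  closure (Set.range fun c : ConfMod V ι => dirMod c)

abbrev CAngle : Type := cangleSet V ι

/-- The projection `Q̃ : C̃_ι[V] → C̃_ι⟨V⟩` which forgets the coordinates in `[0, ∞]`. -/
def projQ : C(CBar V ι, CAngle V ι) where
  toFun x := ⟨x.1.1, map_mem_closure continuous_fst x.2 (by rintro _ ⟨c, rfl⟩; exact ⟨c, rfl⟩)⟩
  continuous_toFun := by fun_prop

end Ambient

/-! ### Restriction to a subset of the labels -/

section Restrict

variable {V : Type} [NormedAddCommGroup V] [NormedSpace ℝ V] {ι κ : Type}

/-- Restriction of a point of `C̃_ι[V]` along an injection of label sets `κ ↪ ι`. -/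
def restrictCBar (σ : κ ↪ ι) (x : CBar V ι) : CBar V κ :=
  ⟨(fun p => x.1.1 (p.trans σ), fun t => x.1.2 (t.trans σ)), by
    refine map_mem_closure
      (f := fun z : (C2 ι → Sph V) × (C3 ι → ℝ≥0∞) =>
        ((fun p : C2 κ => z.1 (p.trans σ)), (fun t : C3 κ => z.2 (t.trans σ))))
      (by fun_prop) x.2 ?_
    rintro _ ⟨c, rfl⟩
    induction c using Quotient.inductionOn with
    | h c => exact ⟨Quotient.mk _ ⟨c.1 ∘ σ, c.2.comp σ.injective⟩, rfl⟩⟩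

end Restrict

/-! ### Collinear points and the spaces `R` -/

section Collinear

variable (V : Type) [NormedAddCommGroup V] [NormedSpace ℝ V] (ι : Type)

variable {V} in
/-- Scaling a unit vector by an element of `S⁰ = {1, -1}`. -/
def signSmul (ε : Sph ℝ) (v : Sph V) : Sph V :=
  ⟨ε.1 • v.1, by
    have h1 : ‖ε.1‖ = 1 := norm_eq_of_mem_sphere ε
    have h2 : ‖v.1‖ = 1 := norm_eq_of_mem_sphere v
    simp only [mem_sphere_zero_iff_norm, norm_smul, h1, h2, mul_one]⟩

variable {V ι} in
/-- The map `S × C̃_ι[ℝ] → C̃_ι[V]` sending `(v, x)` to `(π_{ij}(x) • v) × (s_{ijk}(x))`. -/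
def lineMap (w : Sph V × CBar ℝ ι) : CBar V ι :=
  ⟨(fun p => signSmul (w.2.1.1 p) w.1, w.2.1.2), by
    obtain ⟨v, x⟩ := w
    have hv : ‖v.1‖ = 1 := norm_eq_of_mem_sphere v
    have hv0 : v.1 ≠ 0 := fun h => by simp [h] at hv
    refine map_mem_closure
      (f := fun z : (C2 ι → Sph ℝ) × (C3 ι → ℝ≥0∞) =>
        ((fun p : C2 ι => signSmul (z.1 p) v), z.2)) ?_ x.2 ?_
    · unfold signSmul
      fun_prop
    rintro _ ⟨c, rfl⟩
    induction c using Quotient.inductionOn with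
    | h c =>
      refine ⟨Quotient.mk _ ⟨fun i => c.1 i • v.1, fun i j h =>
        c.2 (smul_left_injective ℝ hv0 h)⟩, ?_⟩
      refine Prod.ext ?_ ?_
      · funext p
        apply Subtype.ext
        simp [dirMod, dir, signSmul, ← sub_smul, norm_smul, hv, smul_smul]
      · funext t
        simp [ratioMod, ratio, ← sub_smul, norm_smul, hv]⟩

/-- The subspace `λ_ι` of collinear points of `C̃_ι[V]`. -/
def collinearSet : Set (CBar V ι) := Set.range (lineMap (V := V) (ι := ι))

/-- The space `S × Σ_ι`, where the set `Σ_ι` of orderings of the labels is realised as the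
set of connected components of `C̃_ι[ℝ]` (one associahedron for each ordering). -/
abbrev SphSigma : Type := Sph V × ConnectedComponents (CBar ℝ ι)

variable {V ι} in
/-- The projection `q : S × C̃_ι[ℝ] → S × Σ_ι` sending each component of `C̃_ι[ℝ]` to a
point. -/
def collapse (w : Sph V × CBar ℝ ι) : SphSigma V ι := (w.1, ConnectedComponents.mk w.2)

/-- The relation on the disjoint union of `S × Σ_ι` and `C̃_ι[V]` which identifies `q w`
with the collinear point given by `w`. -/
inductive RRel : SphSigma V ι ⊕ CBar V ι → SphSigma V ι ⊕ CBar V ι → Prop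
  | glue (w : Sph V × CBar ℝ ι) : RRel (Sum.inl (collapse w)) (Sum.inr (lineMap w))

/-- The space `R_ι`: the pushout of `S × Σ_ι ← S × C̃_ι[ℝ] → C̃_ι[V]`. -/
abbrev R : Type := Quot (RRel V ι)

variable {V ι} in
/-- The canonical map `C̃_ι[V] → R_ι`. -/
def toR (x : CBar V ι) : R V ι := Quot.mk _ (Sum.inr x)

variable {V ι} in
/-- The canonical map `S × Σ_ι → R_ι`. -/
def sigmaToR (s : SphSigma V ι) : R V ι := Quot.mk _ (Sum.inl s)

end Collinear

/-- The fat wedge of the `X i` at the subsets `A i`: the points of the product with at least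
one coordinate `x i` in `A i`. -/
def fatWedge {I : Type} {X : I → Type} (A : ∀ i, Set (X i)) : Set (∀ i, X i) :=
  {x | ∃ i, x i ∈ A i}

/-! ### Trees -/

section Trees

variable (ι : Type)

/-- A rooted tree with trunk, with leaves labelled by `ι` and without bivalent internal
vertices. It is recorded by its parenthesization: an internal vertex is the set of labels of
the leaves lying over it. The vertex at the top of the trunk is the set of all labels (if
there are at least two labels; with fewer labels there is no internal vertex). -/
@[ext] structure TrunkTree where
  /-- The internal vertices. -/
  vertices : Set (Set ι)
  nontrivial : ∀ A ∈ vertices, A.Nontrivial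
  nested : ∀ A ∈ vertices, ∀ B ∈ vertices, A ⊆ B ∨ B ⊆ A ∨ Disjoint A B
  univ_mem : (Set.univ : Set ι).Nontrivial → Set.univ ∈ vertices

variable {ι}

namespace TrunkTree

/-- `T.IsEdge A B`: the vertex (internal vertex or leaf) whose set of leaves is `B` is the
terminal vertex of an edge with initial vertex `A`. -/
def IsEdge (T : TrunkTree ι) (A B : Set ι) : Prop :=
  (B ∈ T.vertices ∨ ∃ i, B = {i}) ∧ B ⊂ A ∧ ∀ A' ∈ T.vertices, ¬ (B ⊂ A' ∧ A' ⊂ A)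

/-- `E(v)`: the edges for which `v` is initial, each given by the set of leaves over it. -/
abbrev Edges (T : TrunkTree ι) (v : T.vertices) : Type := {B : Set ι // T.IsEdge v.1 B}

theorem edge_nonempty (T : TrunkTree ι) (v : T.vertices) (e : T.Edges v) : e.1.Nonempty := by
  rcases e.2.1 with h | ⟨i, h⟩
  · exact (T.nontrivial _ h).nonempty
  · rw [h]; exact Set.singleton_nonempty i

theorem edge_eq_of_mem (T : TrunkTree ι) (v : T.vertices) (e f : T.Edges v) (i : ι)
    (he : i ∈ e.1) (hf : i ∈ f.1) : e = f := by
  have key : ∀ e f : T.Edges v, e.1 ⊆ f.1 → f.1 ∈ T.vertices → e = f := by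
    intro e f h hf
    by_contra hne
    exact e.2.2.2 _ hf ⟨h.ssubset_of_ne fun h => hne (Subtype.ext h), f.2.2.1⟩
  rcases e.2.1 with h1 | ⟨a, h1⟩ <;> rcases f.2.1 with h2 | ⟨b, h2⟩
  · rcases T.nested _ h1 _ h2 with h | h | h
    · exact key e f h h2
    · exact (key f e h h1).symm
    · exact absurd hf (Set.disjoint_left.1 h he)
  · refine (key f e ?_ h1).symm
    rw [h2] at hf ⊢
    rw [Set.mem_singleton_iff] at hf
    simpa [← hf] using he
  · refine key e f ?_ h2
    rw [h1] at he ⊢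
    rw [Set.mem_singleton_iff] at he
    simpa [← he] using hf
  · apply Subtype.ext
    rw [h1, h2]
    rw [h1, Set.mem_singleton_iff] at he
    rw [h2, Set.mem_singleton_iff] at hf
    rw [← he, ← hf]

/-- A choice of one leaf lying over each edge with initial vertex `v`. -/
def leaf (T : TrunkTree ι) (v : T.vertices) : T.Edges v ↪ ι where
  toFun e := (T.edge_nonempty v e).some
  inj' e f h := T.edge_eq_of_mem v e f _ (T.edge_nonempty v e).some_mem
    (by simpa only [h] using (T.edge_nonempty v f).some_mem)

end TrunkTree

end Trees

/-! ### Strata, the fat wedges `λ_T`, the spaces `L_T` and their unions -/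

section Strata

variable {V : Type} [NormedAddCommGroup V] [NormedSpace ℝ V] {ι : Type}

/-- The exclusion relation of `x`: `i` and `j` exclude `k` when `d_{ijk} = 0`. -/
def Excludes (x : CBar V ι) (i j k : ι) : Prop :=
  ∃ t : C3 ι, t 0 = i ∧ t 1 = j ∧ t 2 = k ∧ x.1.2 t = 0

/-- The internal vertices of the tree `T(x)` of a point `x`: the sets consisting of `i` and of
all `j` such that `i` and `j` exclude `k`, when there is such a `j`, together with the set of
all labels. -/
def treeVertices (x : CBar V ι) : Set (Set ι) :=
  {A | ∃ i k, (∃ j, Excludes x i j k) ∧ A = insert i {j | Excludes x i j k}} ∪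
    {A | A = Set.univ ∧ A.Nontrivial}

variable (V)

/-- The open stratum `C̃_T(V)` of points of `C̃_ι[V]` whose tree is `T`. -/
def stratum (T : TrunkTree ι) : Set (CBar V ι) := {x | treeVertices x = T.vertices}

/-- The closed stratum `C̃_T[V]`, the closure of `C̃_T(V)` in `C̃_ι[V]`. -/
def closedStratum (T : TrunkTree ι) : Set (CBar V ι) := closure (stratum V T)

variable {V}

/-- The map `x ↦ (x_v)` which identifies the closed stratum `C̃_T[V]` with the product of the
spaces `C̃_{E(v)}[V]` over the internal vertices `v` of `T`; here `x_v` is the restriction of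
`x` to labels chosen over the edges with initial vertex `v`. -/
def vertexCoords (T : TrunkTree ι) (x : CBar V ι) (v : T.vertices) : CBar V (T.Edges v) :=
  restrictCBar (T.leaf v) x

variable (V)

/-- `λ_T ⊆ C̃_T[V]`: the fat wedge of the spaces `C̃_{E(v)}[V]` at their subspaces of collinear
points. -/
def lambdaT (T : TrunkTree ι) : Set (CBar V ι) :=
  closedStratum V T ∩
    vertexCoords T ⁻¹' fatWedge fun v : T.vertices => collinearSet V (T.Edges v)

/-- `L_T`: the fat wedge of the spaces `R_{E(v)}` at the images of the `S × Σ_{E(v)}`. -/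
def LT (T : TrunkTree ι) : Set (∀ v : T.vertices, R V (T.Edges v)) :=
  fatWedge fun v : T.vertices => Set.range (sigmaToR (V := V) (ι := T.Edges v))

variable {V}

/-- The map `q_T : λ_T → L_T`, which at each vertex is the canonical map to `R_{E(v)}`. -/
def qT (T : TrunkTree ι) (x : lambdaT V T) : LT V T :=
  ⟨fun v => toR (vertexCoords T x.1 v), by
    obtain ⟨v, w, hw⟩ := x.2.2
    refine ⟨v, collapse w, ?_⟩
    change sigmaToR (collapse w) = toR (vertexCoords T x.1 v)
    rw [← hw]
    exact Quot.sound (RRel.glue w)⟩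

variable (V ι)

/-- The union of the `λ_T` in `C̃_ι[V]`. -/
def unionLambda : Set (CBar V ι) := ⋃ T : TrunkTree ι, lambdaT V T

/-- The identifications `q_T(x) ∼ q_{T'}(x)`, for `x` in both `λ_T` and `λ_{T'}`. -/
inductive LRel : (Σ T : TrunkTree ι, LT V T) → (Σ T : TrunkTree ι, LT V T) → Prop
  | glue (T T' : TrunkTree ι) (x : CBar V ι) (h : x ∈ lambdaT V T) (h' : x ∈ lambdaT V T') :
      LRel ⟨T, qT T ⟨x, h⟩⟩ ⟨T', qT T' ⟨x, h'⟩⟩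

/-- The union of the `L_T`: the quotient of their disjoint union by these identifications. -/
abbrev UnionL : Type := Quot (LRel V ι)

/-- The inclusion of the union of the `λ_T` in `C̃_ι[V]`. -/
def unionIncl : C(unionLambda V ι, CBar V ι) := ⟨Subtype.val, continuous_subtype_val⟩

/-- The map `⋃ q_T : ⋃ λ_T → ⋃ L_T`. -/
def unionQ (x : unionLambda V ι) : UnionL V ι :=
  Quot.mk _ ⟨(Set.mem_iUnion.1 x.2).choose, qT _ ⟨x.1, (Set.mem_iUnion.1 x.2).choose_spec⟩⟩

/-- The map `⋃ q_T` restricts to `q_T` on each `λ_T`. -/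
theorem unionQ_eq (x : unionLambda V ι) (T : TrunkTree ι) (h : x.1 ∈ lambdaT V T) :
    unionQ V ι x = Quot.mk _ ⟨T, qT T ⟨x.1, h⟩⟩ :=
  Quot.sound (LRel.glue _ _ _ _ _)

end Strata

end ConfigSpace

end

/-! The projection from the compact space of directions and ratios to the space of directions is a
closed surjection, hence a quotient map. By `isPushout_of_isQuotientMap` the square is a pushout
once it commutes, `unionQ` is surjective, and two distinct points of one fibre always lie in a
common λ_T with the same image under `qT`. This last fact is `eq_or_qT_eq`.

For it, a set of labels is a `Cluster` of x when its labels are infinitely close as seen from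
outside. Clusters of one point are nested, and the closed stratum of T consists of the points having
all vertices of T as clusters (`mem_closedStratum_iff`). Such a point is determined by its
coordinates at the vertices, and any family of coordinates occurs (`glue`,
`exists_vertexCoords_eq`). For x and y with equal directions take the tree of their common clusters.
At each vertex the two coordinates have equal directions and no proper common cluster with two
labels, and `along_or_eq` gives a dichotomy. Either all directions lie along one line, and then both
coordinates are collinear with the same ordering, so that they agree in R (`toR_eq_of_along`); or
the coordinates are equal. In the second case both largest-scale configurations (`exists_top`) are
injective and not on a line, because a failure would produce a proper common cluster, and such
configurations are determined up to similarity by their directions.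

For the homotopy equivalence, both compactifications are deformed into the space of configurations.
Closeness of a configuration to a boundary point is expressed by conditions that are convex in the
configuration, so a partition of unity selects close configurations continuously
(`exists_homotopic_interior`). The selections r on the domain and s on the target both make acute
angles with the given directions, so r and s ∘ Q̃ are joined by segments of injective
configurations. Hence s followed by the inclusion of configurations is a homotopy inverse. -/

noncomputable section

set_option linter.unusedSectionVars false

namespace ConfigSpace

open Filter

/-! ### Total versions of the coordinates -/

section TotalCoordinates

variable {V : Type} [NormedAddCommGroup V] [NormedSpace ℝ V] {ι : Type}

/-- The pair `(i, j)` of distinct labels. -/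
def pair {i j : ι} (h : i ≠ j) : C2 ι :=
  ⟨![i, j], by
    intro a b hab
    fin_cases a <;> fin_cases b <;> simp_all [h.symm]⟩

/-- The triple `(i, j, k)` of distinct labels. -/
def triple {i j k : ι} (h : i ≠ j ∧ i ≠ k ∧ j ≠ k) : C3 ι :=
  ⟨![i, j, k], by
    obtain ⟨h1, h2, h3⟩ := h
    intro a b hab
    fin_cases a <;> fin_cases b <;> simp_all [h1.symm, h2.symm, h3.symm]⟩

@[simp] theorem pair_zero {i j : ι} (h : i ≠ j) : pair h 0 = i := rfl

@[simp] theorem pair_one {i j : ι} (h : i ≠ j) : pair h 1 = j := rfl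

@[simp] theorem triple_zero {i j k : ι} (h : i ≠ j ∧ i ≠ k ∧ j ≠ k) : triple h 0 = i := rfl

@[simp] theorem triple_one {i j k : ι} (h : i ≠ j ∧ i ≠ k ∧ j ≠ k) : triple h 1 = j := rfl

@[simp] theorem triple_two {i j k : ι} (h : i ≠ j ∧ i ≠ k ∧ j ≠ k) : triple h 2 = k := rfl

theorem pair_ne (p : C2 ι) : p 0 ≠ p 1 := fun h => by simpa using p.injective h

theorem triple_ne (t : C3 ι) : t 0 ≠ t 1 ∧ t 0 ≠ t 2 ∧ t 1 ≠ t 2 :=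
  ⟨fun h => by simpa using t.injective h, fun h => by simpa using t.injective h,
    fun h => by simpa using t.injective h⟩

theorem pair_eta (p : C2 ι) (h : p 0 ≠ p 1) : pair h = p := by
  ext a; fin_cases a <;> rfl

theorem triple_eta (t : C3 ι) (h : t 0 ≠ t 1 ∧ t 0 ≠ t 2 ∧ t 1 ≠ t 2) : triple h = t := by
  ext a; fin_cases a <;> rfl

open Classical in
/-- The direction from `j` to `i`, extended by `0` to equal labels. -/
def uu (u : C2 ι → Sph V) (i j : ι) : V := if h : i ≠ j then (u (pair h)).1 else 0

open Classical in
/-- The ratio `d_{ijk}`, extended to triples of labels which are not all equal, as the ratio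
of the distance from `i` to `j` to the distance from `i` to `k`. -/
def dd (d : C3 ι → ℝ≥0∞) (i j k : ι) : ℝ≥0∞ :=
  -- The values 0, ∞ and 1 are those of the quotient of distances on degenerate triples, so the
  -- limit formulas need no distinctness of all three labels.
  if h : i ≠ j ∧ i ≠ k ∧ j ≠ k then d (triple h) else if i = j then 0 else if i = k then ∞ else 1

theorem uu_pair (u : C2 ι → Sph V) (p : C2 ι) : uu u (p 0) (p 1) = u p := by
  rw [uu, dif_pos (pair_ne p), pair_eta]

theorem uu_of_ne (u : C2 ι → Sph V) {i j : ι} (h : i ≠ j) : uu u i j = u (pair h) := dif_pos h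

@[simp] theorem uu_self (u : C2 ι → Sph V) (i : ι) : uu u i i = 0 := by simp [uu]

theorem norm_uu (u : C2 ι → Sph V) {i j : ι} (h : i ≠ j) : ‖uu u i j‖ = 1 := by
  rw [uu_of_ne u h]; exact norm_eq_of_mem_sphere _

theorem dd_triple (d : C3 ι → ℝ≥0∞) (t : C3 ι) : dd d (t 0) (t 1) (t 2) = d t := by
  rw [dd, dif_pos (triple_ne t), triple_eta]

theorem dd_of_ne (d : C3 ι → ℝ≥0∞) {i j k : ι} (h : i ≠ j ∧ i ≠ k ∧ j ≠ k) :
    dd d i j k = d (triple h) := dif_pos h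

@[simp] theorem dd_left (d : C3 ι → ℝ≥0∞) (i k : ι) : dd d i i k = 0 := by simp [dd]

theorem dd_mid (d : C3 ι → ℝ≥0∞) {i j : ι} (h : i ≠ j) : dd d i j i = ∞ := by simp [dd, h]

theorem dd_right (d : C3 ι → ℝ≥0∞) {i j : ι} (h : i ≠ j) : dd d i j j = 1 := by simp [dd, h]

theorem continuous_uu (i j : ι) : Continuous fun u : C2 ι → Sph V => uu u i j := by
  unfold uu
  split_ifs <;> fun_prop

theorem continuous_dd (i j k : ι) : Continuous fun d : C3 ι → ℝ≥0∞ => dd d i j k := by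
  unfold dd
  split_ifs <;> fun_prop

theorem dirs_ext {u u' : C2 ι → Sph V} (h : ∀ i j, i ≠ j → uu u i j = uu u' i j) : u = u' := by
  funext p
  apply Subtype.ext
  rw [← uu_pair, ← uu_pair]
  exact h _ _ (pair_ne p)

theorem ratios_ext {d d' : C3 ι → ℝ≥0∞}
    (h : ∀ i j k, i ≠ j → i ≠ k → j ≠ k → dd d i j k = dd d' i j k) : d = d' := by
  funext t
  rw [← dd_triple d, ← dd_triple d']
  obtain ⟨h1, h2, h3⟩ := triple_ne t
  exact h _ _ _ h1 h2 h3

theorem uu_restrict {κ : Type} (σ : κ ↪ ι) (x : CBar V ι) (i j : κ) :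
    uu (restrictCBar σ x).1.1 i j = uu x.1.1 (σ i) (σ j) := by
  by_cases h : i = j
  · simp [h]
  · have h' : σ i ≠ σ j := fun e => h (σ.injective e)
    rw [uu_of_ne _ h, uu_of_ne _ h']
    change (x.1.1 ((pair h).trans σ)).1 = _
    have : (pair h).trans σ = pair h' := by ext a; fin_cases a <;> rfl
    rw [this]

theorem dd_restrict {κ : Type} (σ : κ ↪ ι) (x : CBar V ι) (i j k : κ) :
    dd (restrictCBar σ x).1.2 i j k = dd x.1.2 (σ i) (σ j) (σ k) := by
  by_cases h : i ≠ j ∧ i ≠ k ∧ j ≠ k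
  · have h' : σ i ≠ σ j ∧ σ i ≠ σ k ∧ σ j ≠ σ k := by simpa using h
    rw [dd_of_ne _ h, dd_of_ne _ h']
    change x.1.2 ((triple h).trans σ) = _
    have : (triple h).trans σ = triple h' := by ext a; fin_cases a <;> rfl
    rw [this]
  · have h' : ¬ (σ i ≠ σ j ∧ σ i ≠ σ k ∧ σ j ≠ σ k) := by simpa using h
    rw [dd, dif_neg h, dd, dif_neg h']
    by_cases h1 : i = j
    · rw [if_pos h1, if_pos (congrArg σ h1)]
    · rw [if_neg h1, if_neg (σ.injective.ne h1)]
      by_cases h2 : i = k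
      · rw [if_pos h2, if_pos (congrArg σ h2)]
      · rw [if_neg h2, if_neg (σ.injective.ne h2)]

theorem excludes_iff (x : CBar V ι) (i j k : ι) :
    Excludes x i j k ↔ (i ≠ j ∧ i ≠ k ∧ j ≠ k) ∧ dd x.1.2 i j k = 0 := by
  constructor
  · rintro ⟨t, rfl, rfl, rfl, h⟩
    exact ⟨triple_ne t, by rw [dd_triple, h]⟩
  · rintro ⟨h, h0⟩
    exact ⟨triple h, rfl, rfl, rfl, by rw [← dd_of_ne x.1.2, h0]⟩

/-- The conventions 0 for a = i and 1 for a = k absorb the inserted label, so a vertex of the tree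
becomes the zero set of a single ratio. -/
theorem mem_insert_excludes_iff (x : CBar V ι) {i k : ι} (hik : i ≠ k) (a : ι) :
    a ∈ insert i {j | Excludes x i j k} ↔ dd x.1.2 i a k = 0 := by
  by_cases h1 : a = i
  · simp [h1]
  · by_cases h2 : a = k
    · subst h2
      simp [excludes_iff, dd_right _ hik, h1]
    · simp [excludes_iff, h1, h2, Ne.symm h1, hik]

/-! ### Limits of configurations -/

theorem uu_dir (c : Conf V ι) (i j : ι) :
    uu (dir c) i j = ‖c.1 i - c.1 j‖⁻¹ • (c.1 i - c.1 j) := by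
  by_cases h : i = j
  · simp [h]
  · rw [uu_of_ne _ h]; rfl

theorem conf_sub_ne (c : Conf V ι) {i j : ι} (h : i ≠ j) : c.1 i - c.1 j ≠ 0 :=
  sub_ne_zero.2 fun e => h (c.2 e)

theorem dd_ratio (c : Conf V ι) {i j k : ι} (h : i ≠ j ∨ i ≠ k) :
    dd (ratio c) i j k = ‖c.1 i - c.1 j‖ₑ / ‖c.1 i - c.1 k‖ₑ := by
  by_cases h' : i ≠ j ∧ i ≠ k ∧ j ≠ k
  · rw [dd_of_ne _ h']
    have := norm_pos_iff.2 (conf_sub_ne c h'.2.1)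
    change ENNReal.ofReal (‖c.1 i - c.1 j‖ / ‖c.1 i - c.1 k‖) = _
    rw [ENNReal.ofReal_div_of_pos this, ofReal_norm, ofReal_norm]
  · by_cases hij : i = j
    · subst hij; simp
    · by_cases hik : i = k
      · subst hik
        have := conf_sub_ne c hij
        rw [dd_mid _ hij]
        simp [ENNReal.div_zero, this]
      · have hjk : j = k := by
          by_contra hjk; exact h' ⟨hij, hik, hjk⟩
        subst hjk
        rw [dd_right _ hij, ENNReal.div_self] <;> simp [conf_sub_ne c hij]

variable {α : Type*} {F : Filter α}

theorem tendsto_uu (c : α → Conf V ι) (r : α → ℝ) (hr : ∀ a, 0 < r a) {i j : ι} {q : V}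
    (h : Tendsto (fun a => r a • ((c a).1 i - (c a).1 j)) F (𝓝 q)) (hq : q ≠ 0) :
    Tendsto (fun a => uu (dir (c a)) i j) F (𝓝 (‖q‖⁻¹ • q)) := by
  have h1 := (h.norm.inv₀ (norm_ne_zero_iff.2 hq)).smul h
  refine h1.congr fun a => ?_
  rw [uu_dir, norm_smul, Real.norm_eq_abs, abs_of_pos (hr a), smul_smul, mul_inv]
  congr 1
  have := (hr a).ne'
  field_simp

/-- Rescaling does not change ratios, and division of finite values in [0, ∞] is continuous away
from 0/0; one nonzero limit therefore suffices. -/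
theorem tendsto_dd [F.NeBot] (c : α → Conf V ι) (r : α → ℝ) (hr : ∀ a, 0 < r a) {i j k : ι}
    {q q' : V} (h : Tendsto (fun a => r a • ((c a).1 i - (c a).1 j)) F (𝓝 q))
    (h' : Tendsto (fun a => r a • ((c a).1 i - (c a).1 k)) F (𝓝 q')) (hq : q ≠ 0 ∨ q' ≠ 0) :
    Tendsto (fun a => dd (ratio (c a)) i j k) F (𝓝 (‖q‖ₑ / ‖q'‖ₑ)) := by
  have hne : i ≠ j ∨ i ≠ k := by
    by_contra hcon
    push Not at hcon
    obtain ⟨rfl, rfl⟩ := hcon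
    simp only [sub_self, smul_zero] at h h'
    have e1 := tendsto_nhds_unique h tendsto_const_nhds
    have e2 := tendsto_nhds_unique h' tendsto_const_nhds
    simp [e1, e2] at hq
  have := ENNReal.Tendsto.div h.enorm (by simpa using hq) h'.enorm (by simp)
  refine this.congr fun a => ?_
  have e0 : ‖r a‖ₑ ≠ 0 := by simpa using (hr a).ne'
  rw [dd_ratio _ hne, enorm_smul, enorm_smul, ENNReal.mul_div_mul_left _ _ e0 (by simp)]

theorem cbarSet_eq :
    cbarSet V ι = closure (Set.range fun c : Conf V ι => (dir c, ratio c)) := by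
  unfold cbarSet
  congr 1
  exact (Quotient.mk_surjective (s := simSetoid V ι)).range_comp
    (fun c : ConfMod V ι => (dirMod c, ratioMod c)) ▸ rfl

theorem cangleSet_eq :
    cangleSet V ι = closure (Set.range fun c : Conf V ι => dir c) := by
  unfold cangleSet
  congr 1
  exact (Quotient.mk_surjective (s := simSetoid V ι)).range_comp
    (fun c : ConfMod V ι => dirMod c) ▸ rfl

theorem exists_filter (x : CBar V ι) : ∃ F : Filter (Conf V ι), F.NeBot ∧
    Tendsto (fun c => (dir c, ratio c)) F (𝓝 x.1) := by
  have hx : x.1 ∈ closure (Set.range fun c : Conf V ι => (dir c, ratio c)) :=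
    cbarSet_eq (V := V) (ι := ι) ▸ x.2
  rw [mem_closure_iff_frequently] at hx
  exact ⟨comap (fun c => (dir c, ratio c)) (𝓝 x.1), comap_neBot_iff_frequently.2 hx,
    tendsto_comap⟩

/-- The configuration formed by the labels in `s` at their largest scale. -/
theorem exists_top [FiniteDimensional ℝ V] (x : CBar V ι) (s : Set ι) (hf : s.Finite)
    (hs : s.Nontrivial) :
    ∃ p : ι → V, (∀ a ∈ s, ∃ i ∈ s, p i ≠ p a) ∧
      (∀ i ∈ s, ∀ j ∈ s, p i ≠ p j → uu x.1.1 i j = ‖p i - p j‖⁻¹ • (p i - p j)) ∧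
      ∀ i ∈ s, ∀ j ∈ s, ∀ k ∈ s, p i ≠ p j ∨ p i ≠ p k →
        dd x.1.2 i j k = ‖p i - p j‖ₑ / ‖p i - p k‖ₑ := by
  classical
  obtain ⟨F, hF, hx⟩ := exists_filter x
  have := hf.fintype
  obtain ⟨i0, hi0, j0, hj0, hne⟩ := hs
  -- Translating the label i0 to the origin and normalising in the sup norm puts the configurations
  -- on a compact sphere; p is their limit along an ultrafilter.
  let Q : Conf V ι → (s → V) := fun c i => c.1 i - c.1 i0
  have hQ : ∀ c, Q c ≠ 0 := fun c h => conf_sub_ne c hne.symm (congrFun h ⟨j0, hj0⟩)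
  have hQs : ∀ c, ‖Q c‖⁻¹ • Q c ∈ Metric.sphere (0 : s → V) 1 := fun c => by
    rw [mem_sphere_zero_iff_norm, norm_smul, norm_inv, norm_norm,
      inv_mul_cancel₀ (norm_ne_zero_iff.2 (hQ c))]
  let U := Ultrafilter.of F
  obtain ⟨q, hq, hqU⟩ := (isCompact_sphere (0 : s → V) 1).ultrafilter_le_nhds
    (U.map fun c => ‖Q c‖⁻¹ • Q c) (by
      rw [le_principal_iff]
      exact Filter.univ_mem' (f := (U : Filter (Conf V ι))) hQs)
  have hx' := hx.mono_left (Ultrafilter.of_le F)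
  let p : ι → V := fun i => if h : i ∈ s then q ⟨i, h⟩ else 0
  have hlim : ∀ i ∈ s, Tendsto (fun c : Conf V ι => ‖Q c‖⁻¹ • (c.1 i - c.1 i0)) U (𝓝 (p i)) := by
    intro i hi
    have h1 : Tendsto (fun c => ‖Q c‖⁻¹ • Q c) U (𝓝 q) := hqU
    have := (tendsto_pi_nhds.1 h1) ⟨i, hi⟩
    simpa [p, hi] using this
  have hlim2 : ∀ i ∈ s, ∀ j ∈ s,
      Tendsto (fun c : Conf V ι => ‖Q c‖⁻¹ • (c.1 i - c.1 j)) U (𝓝 (p i - p j)) := by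
    intro i hi j hj
    refine ((hlim i hi).sub (hlim j hj)).congr fun c => ?_
    rw [← smul_sub]; congr 1; abel
  have hr : ∀ c, 0 < ‖Q c‖⁻¹ := fun c => inv_pos.2 (norm_pos_iff.2 (hQ c))
  have hp0 : p i0 = 0 :=
    tendsto_nhds_unique (hlim i0 hi0) (by simp)
  refine ⟨p, ?_, ?_, ?_⟩
  · intro a ha
    by_contra hcon
    push Not at hcon
    -- A constant p would vanish because it vanishes at i0, whereas q has norm 1.
    have : q = 0 := by
      funext i
      have h1 : p i = p i0 := (hcon i i.2).trans (hcon i0 hi0).symm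
      simpa [p, hp0] using h1
    simp [this] at hq
  · intro i hi j hj hij
    refine tendsto_nhds_unique ?_ (tendsto_uu (F := (U : Filter (Conf V ι))) id
      (fun c => ‖Q c‖⁻¹) hr (hlim2 i hi j hj) (sub_ne_zero.2 hij))
    exact ((continuous_uu i j).tendsto _).comp ((continuous_fst.tendsto _).comp hx')
  · intro i hi j hj k hk h
    refine tendsto_nhds_unique ?_ (tendsto_dd (F := (U : Filter (Conf V ι))) id
      (fun c => ‖Q c‖⁻¹) hr (hlim2 i hi j hj) (hlim2 i hi k hk) (by simpa [sub_ne_zero] using h))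
    exact ((continuous_dd i j k).tendsto _).comp ((continuous_snd.tendsto _).comp hx')

/-! ### Clusters -/

/-- The labels in `A` are infinitely close to each other, as seen from any label outside. -/
def Cluster (x : CBar V ι) (A : Set ι) : Prop :=
  ∀ i ∈ A, ∀ j ∈ A, ∀ k ∉ A, dd x.1.2 i j k = 0

theorem enorm_div_eq_zero {a b c : V} (h : ‖a - b‖ₑ / ‖a - c‖ₑ = 0) : a = b := by
  simpa [ENNReal.div_eq_zero_iff, sub_eq_zero] using h

/-- At the largest scale of a set of labels which it does not contain, a cluster is a point. -/
theorem Cluster.eq_of_top {x : CBar V ι} {A : Set ι} (hA : Cluster x A) {s : Set ι} {p : ι → V}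
    (hp : ∀ i ∈ s, ∀ j ∈ s, ∀ k ∈ s, p i ≠ p j ∨ p i ≠ p k →
        dd x.1.2 i j k = ‖p i - p j‖ₑ / ‖p i - p k‖ₑ)
    {i j k : ι} (hi : i ∈ A) (hj : j ∈ A) (hk : k ∉ A) (his : i ∈ s) (hjs : j ∈ s)
    (hks : k ∈ s) : p i = p j := by
  by_contra hne
  exact hne (enorm_div_eq_zero ((hp i his j hjs k hks (Or.inl hne)).symm.trans
    (hA i hi j hj k hk)))

theorem cluster_univ (x : CBar V ι) : Cluster x Set.univ :=
  fun _ _ _ _ k hk => absurd (Set.mem_univ k) hk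

variable [FiniteDimensional ℝ V]

/-- Otherwise take a in both, b only in A and c only in B. At the largest scale of these three
labels A forces a = b and B forces a = c, but the configuration is not constant. -/
theorem Cluster.nested {x : CBar V ι} {A B : Set ι} (hA : Cluster x A) (hB : Cluster x B) :
    A ⊆ B ∨ B ⊆ A ∨ Disjoint A B := by
  by_contra hcon
  push Not at hcon
  obtain ⟨h1, h2, h3⟩ := hcon
  obtain ⟨b, hbA, hbB⟩ := Set.not_subset.1 h1
  obtain ⟨c, hcB, hcA⟩ := Set.not_subset.1 h2
  obtain ⟨a, haA, haB⟩ := Set.not_disjoint_iff.1 h3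
  obtain ⟨p, hne, -, hd⟩ := exists_top x {a, b, c} (by simp)
    ⟨a, by simp, b, by simp, fun h => hbB (h ▸ haB)⟩
  have e1 := hA.eq_of_top hd haA hbA hcA (by simp) (by simp) (by simp)
  have e2 := hB.eq_of_top hd haB hcB hbB (by simp) (by simp) (by simp)
  obtain ⟨i, hi, hi'⟩ := hne a (by simp)
  simp only [Set.mem_insert_iff, Set.mem_singleton_iff] at hi
  rcases hi with rfl | rfl | rfl <;> simp_all

/-- At the largest scale of the four labels a, b and e occupy one point, so c must occupy another.
-/
theorem dd_zero_trans {x : CBar V ι} {a b e c : ι} (hac : a ≠ c) (h1 : dd x.1.2 a b c = 0)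
    (h2 : dd x.1.2 b e c = 0) : dd x.1.2 a e c = 0 := by
  obtain ⟨p, hne, -, hd⟩ := exists_top x {a, b, e, c} (by simp) ⟨a, by simp, c, by simp, hac⟩
  have hab : p a = p b := by
    by_contra h
    exact h (enorm_div_eq_zero ((hd a (by simp) b (by simp) c (by simp) (Or.inl h)).symm.trans h1))
  have hbe : p b = p e := by
    by_contra h
    exact h (enorm_div_eq_zero ((hd b (by simp) e (by simp) c (by simp) (Or.inl h)).symm.trans h2))
  have hca : p a ≠ p c := by
    intro h
    obtain ⟨i, hi, hi'⟩ := hne a (by simp)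
    simp only [Set.mem_insert_iff, Set.mem_singleton_iff] at hi
    rcases hi with rfl | rfl | rfl | rfl <;> simp_all
  rw [hd a (by simp) e (by simp) c (by simp) (Or.inr hca), hab, hbe]
  simp

/-- At the largest scale of i, a, b, c, k, members a and b of the vertex sit at the position of i,
and a non-member c does not. -/
theorem cluster_of_mem_treeVertices {x : CBar V ι} {A : Set ι} (hA : A ∈ treeVertices x) :
    Cluster x A := by
  rcases hA with ⟨i, k, ⟨j, hj⟩, rfl⟩ | ⟨rfl, -⟩
  · rw [excludes_iff] at hj
    have hik := hj.1.2.1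
    intro a ha b hb c hc
    rw [mem_insert_excludes_iff x hik] at ha hb hc
    obtain ⟨p, hne, -, hd⟩ := exists_top x {i, a, b, c, k} (by simp)
      ⟨i, by simp, k, by simp, hik⟩
    have hia : p i = p a := by
      by_contra h
      exact h (enorm_div_eq_zero
        ((hd i (by simp) a (by simp) k (by simp) (Or.inl h)).symm.trans ha))
    have hib : p i = p b := by
      by_contra h
      exact h (enorm_div_eq_zero
        ((hd i (by simp) b (by simp) k (by simp) (Or.inl h)).symm.trans hb))
    have hic : p i ≠ p c := by
      intro h
      by_cases h' : p i = p k
      · obtain ⟨l, hl, hl'⟩ := hne i (by simp)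
        simp only [Set.mem_insert_iff, Set.mem_singleton_iff] at hl
        rcases hl with rfl | rfl | rfl | rfl | rfl <;> simp_all
      · refine hc ?_
        rw [hd i (by simp) c (by simp) k (by simp) (Or.inr h'), h]
        simp
    rw [hd a (by simp) b (by simp) c (by simp) (Or.inr (hia ▸ hic)), ← hia, ← hib]
    simp
  · exact cluster_univ x

theorem isClosed_setOf_cluster (A : Set ι) : IsClosed {x : CBar V ι | Cluster x A} := by
  simp only [Cluster, Set.ofPred_forall]
  refine isClosed_iInter fun i => isClosed_iInter fun _ => isClosed_iInter fun j =>
    isClosed_iInter fun _ => isClosed_iInter fun k => isClosed_iInter fun _ => ?_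
  exact isClosed_eq ((continuous_dd i j k).comp
    (continuous_snd.comp continuous_subtype_val)) continuous_const

theorem cluster_of_mem_closedStratum {T : TrunkTree ι} {x : CBar V ι}
    (hx : x ∈ closedStratum V T) {A : Set ι} (hA : A ∈ T.vertices) : Cluster x A := by
  refine closure_minimal (fun y hy => ?_) (isClosed_setOf_cluster A) hx
  exact cluster_of_mem_treeVertices ((Set.ext_iff.1 hy A).2 hA)

end TotalCoordinates

/-! ### Edges and joins in a tree -/

namespace TrunkTree

variable {ι : Type} [Finite ι] (T : TrunkTree ι)

theorem edge_mem_vertices {v : T.vertices} (e : T.Edges v) (h : e.1.Nontrivial) :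
    e.1 ∈ T.vertices := by
  rcases e.2.1 with h' | ⟨i, hi⟩
  · exact h'
  · rw [hi] at h; exact absurd h Set.not_nontrivial_singleton

theorem exists_edge (v : T.vertices) {i : ι} (hi : i ∈ v.1) : ∃ e : T.Edges v, i ∈ e.1 := by
  obtain ⟨B, hB⟩ := Set.Finite.exists_maximal
    (s := {B : Set ι | (B ∈ T.vertices ∨ ∃ j, B = {j}) ∧ B ⊂ v.1 ∧ i ∈ B}) (Set.toFinite _)
    ⟨{i}, Or.inr ⟨i, rfl⟩, (Set.singleton_subset_iff.2 hi).ssubset_of_ne fun h =>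
      Set.not_nontrivial_singleton (h ▸ T.nontrivial _ v.2), rfl⟩
  refine ⟨⟨B, hB.prop.1, hB.prop.2.1, fun A' hA' h => ?_⟩, hB.prop.2.2⟩
  exact h.1.not_subset (hB.le_of_ge ⟨Or.inl hA', h.2, h.1.subset hB.prop.2.2⟩ h.1.subset)

/-- The edge with initial vertex `v` over which the leaf `i` lies. -/
def edge (v : T.vertices) (i : ι) (hi : i ∈ v.1) : T.Edges v := (T.exists_edge v hi).choose

theorem mem_edge (v : T.vertices) {i : ι} (hi : i ∈ v.1) : i ∈ (T.edge v i hi).1 :=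
  (T.exists_edge v hi).choose_spec

theorem edge_eq {v : T.vertices} {i : ι} (hi : i ∈ v.1) {e : T.Edges v} (h : i ∈ e.1) :
    T.edge v i hi = e :=
  T.edge_eq_of_mem v _ _ i (T.mem_edge v hi) h

theorem edge_subset {v : T.vertices} (e : T.Edges v) : e.1 ⊆ v.1 := e.2.2.1.subset

theorem leaf_mem (v : T.vertices) (e : T.Edges v) : T.leaf v e ∈ e.1 :=
  (T.edge_nonempty v e).some_mem

theorem leaf_mem_vertex (v : T.vertices) (e : T.Edges v) : T.leaf v e ∈ v.1 :=
  T.edge_subset e (T.leaf_mem v e)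

theorem edge_leaf (v : T.vertices) (e : T.Edges v) :
    T.edge v (T.leaf v e) (T.leaf_mem_vertex v e) = e :=
  T.edge_eq _ (T.leaf_mem v e)

/-- The edge and A share the label i, so they are comparable, and A cannot lie strictly between the
edge and v. -/
theorem subset_edge {v : T.vertices} {A : Set ι} (hA : A ∈ T.vertices) (hAv : A ⊂ v.1) {i : ι}
    (hi : i ∈ A) (hiv : i ∈ v.1) : A ⊆ (T.edge v i hiv).1 := by
  set e := T.edge v i hiv
  have hie : i ∈ e.1 := T.mem_edge v hiv
  have hnot : ¬ e.1 ⊂ A := fun h => e.2.2.2 A hA ⟨h, hAv⟩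
  rcases e.2.1 with h | ⟨j, hj⟩
  · rcases T.nested _ hA _ h with h | h | h
    · exact h
    · by_contra hcon; exact hnot ⟨h, hcon⟩
    · exact absurd hie (Set.disjoint_left.1 h hi)
  · have : j = i := by rw [hj] at hie; exact hie.symm
    subst this
    refine absurd ⟨?_, fun h => ?_⟩ hnot
    · rw [hj]; exact Set.singleton_subset_iff.2 hi
    · rw [hj] at h
      exact Set.not_nontrivial_singleton ((T.nontrivial _ hA).mono h)

theorem exists_join {s : Set ι} (hs : s.Nontrivial) :
    ∃ v : T.vertices, s ⊆ v.1 ∧ ∀ e : T.Edges v, ¬ s ⊆ e.1 := by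
  obtain ⟨B, hB⟩ := Set.Finite.exists_minimal (s := {B : Set ι | B ∈ T.vertices ∧ s ⊆ B})
    (Set.toFinite _) ⟨Set.univ, T.univ_mem (hs.mono (Set.subset_univ _)), Set.subset_univ _⟩
  refine ⟨⟨B, hB.prop.1⟩, hB.prop.2, fun e he => ?_⟩
  exact e.2.2.1.not_subset
    (hB.le_of_le ⟨T.edge_mem_vertices e (hs.mono he), he⟩ e.2.2.1.subset)

/-- The least vertex below all the labels in `s`. -/
def join (s : Set ι) (hs : s.Nontrivial) : T.vertices := (T.exists_join hs).choose

theorem subset_join {s : Set ι} (hs : s.Nontrivial) : s ⊆ (T.join s hs).1 :=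
  (T.exists_join hs).choose_spec.1

theorem not_subset_edge_join {s : Set ι} (hs : s.Nontrivial) (e : T.Edges (T.join s hs)) :
    ¬ s ⊆ e.1 :=
  (T.exists_join hs).choose_spec.2 e

/-- Two vertices containing s are nested; if one were strictly smaller, s would lie over a single
edge of the larger. -/
theorem join_eq {s : Set ι} (hs : s.Nontrivial) {v : T.vertices} (hv : s ⊆ v.1)
    (hv' : ∀ e : T.Edges v, ¬ s ⊆ e.1) : T.join s hs = v := by
  obtain ⟨i, hi⟩ := hs.nonempty
  have h1 := T.subset_join hs
  have h2 := T.not_subset_edge_join hs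
  set w := T.join s hs
  have key : ∀ a b : T.vertices, s ⊆ a.1 → s ⊆ b.1 → (∀ e : T.Edges b, ¬ s ⊆ e.1) →
      a.1 ⊆ b.1 → a = b := by
    intro a b ha hb hb' hab
    by_contra hne
    exact hb' _ (ha.trans (T.subset_edge a.2 (hab.ssubset_of_ne fun h => hne (Subtype.ext h))
      (ha hi) (hb hi)))
  rcases T.nested _ w.2 _ v.2 with h | h | h
  · exact key w v h1 hv hv' h
  · exact (key v w hv h1 h2 h).symm
  · exact absurd (hv hi) (Set.disjoint_left.1 h (h1 hi))

theorem exists_parent {A : Set ι} (hA : A ∈ T.vertices) (hne : A ≠ Set.univ) :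
    ∃ v : T.vertices, T.IsEdge v.1 A := by
  obtain ⟨B, hB⟩ := Set.Finite.exists_minimal (s := {B : Set ι | B ∈ T.vertices ∧ A ⊂ B})
    (Set.toFinite _) ⟨Set.univ, T.univ_mem ((T.nontrivial _ hA).mono (Set.subset_univ _)),
      Set.ssubset_univ_iff.2 hne⟩
  exact ⟨⟨B, hB.prop.1⟩, Or.inl hA, hB.prop.2, fun A' hA' h =>
    h.2.not_subset (hB.le_of_le ⟨hA', h.1⟩ h.2.subset)⟩

theorem nontrivial_pair (p : C2 ι) : ({p 0, p 1} : Set ι).Nontrivial :=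
  ⟨p 0, by simp, p 1, by simp, pair_ne p⟩

theorem nontrivial_triple (t : C3 ι) : ({t 0, t 1, t 2} : Set ι).Nontrivial :=
  ⟨t 0, by simp, t 1, by simp, (triple_ne t).1⟩

end TrunkTree

/-! ### Gluing points along a tree -/

section Glue

variable {V : Type} [NormedAddCommGroup V] [NormedSpace ℝ V] {ι : Type} [Finite ι]
  (T : TrunkTree ι)

open TrunkTree

theorem edge_join_ne (p : C2 ι) :
    T.edge (T.join _ (nontrivial_pair p)) (p 0) (T.subset_join _ (by simp)) ≠
      T.edge (T.join _ (nontrivial_pair p)) (p 1) (T.subset_join _ (by simp)) := by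
  intro h
  refine T.not_subset_edge_join (nontrivial_pair p) (T.edge _ (p 0) (T.subset_join _ (by simp))) ?_
  intro a ha
  rcases ha with rfl | rfl
  · exact T.mem_edge _ _
  · rw [h]; exact T.mem_edge _ _

theorem edge_join_ne_triple (t : C3 ι) :
    T.edge (T.join _ (nontrivial_triple t)) (t 0) (T.subset_join _ (by simp)) ≠
      T.edge (T.join _ (nontrivial_triple t)) (t 1) (T.subset_join _ (by simp)) ∨
    T.edge (T.join _ (nontrivial_triple t)) (t 0) (T.subset_join _ (by simp)) ≠
      T.edge (T.join _ (nontrivial_triple t)) (t 2) (T.subset_join _ (by simp)) := by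
  by_contra hcon
  push Not at hcon
  refine T.not_subset_edge_join (nontrivial_triple t)
    (T.edge _ (t 0) (T.subset_join _ (by simp))) ?_
  rintro a (rfl | rfl | rfl)
  · exact T.mem_edge _ _
  · rw [hcon.1]; exact T.mem_edge _ _
  · rw [hcon.2]; exact T.mem_edge _ _

/-- The point assembled from points at the vertices of a tree. -/
def glue (z : ∀ v : T.vertices, (C2 (T.Edges v) → Sph V) × (C3 (T.Edges v) → ℝ≥0∞)) :
    (C2 ι → Sph V) × (C3 ι → ℝ≥0∞) :=
  (fun p => (z (T.join _ (nontrivial_pair p))).1 (pair (edge_join_ne T p)),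
   -- Two of the three labels may lie over one edge of the join; the extended ratio then supplies 0,
   -- ∞ or 1.
   fun t => dd (z (T.join _ (nontrivial_triple t))).2
    (T.edge _ (t 0) (T.subset_join _ (by simp))) (T.edge _ (t 1) (T.subset_join _ (by simp)))
    (T.edge _ (t 2) (T.subset_join _ (by simp))))

theorem continuous_glue : Continuous (glue (V := V) T) := by
  refine Continuous.prodMk (continuous_pi fun p => by fun_prop) (continuous_pi fun t => ?_)
  exact (continuous_dd _ _ _).comp (by fun_prop)

variable (z : ∀ v : T.vertices, (C2 (T.Edges v) → Sph V) × (C3 (T.Edges v) → ℝ≥0∞))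

theorem uu_glue (v : T.vertices) {i j : ι} (hi : i ∈ v.1) (hj : j ∈ v.1)
    (hne : T.edge v i hi ≠ T.edge v j hj) :
    uu (glue T z).1 i j = uu (z v).1 (T.edge v i hi) (T.edge v j hj) := by
  have hij : i ≠ j := by rintro rfl; exact hne rfl
  have hv : T.join _ (nontrivial_pair (pair hij)) = v := by
    refine T.join_eq _ ?_ ?_
    · rintro a (rfl | rfl) <;> assumption
    · intro e he
      exact hne ((T.edge_eq hi (he (by simp))).trans
        (T.edge_eq hj (he (by simp))).symm)
  subst hv
  rw [uu_of_ne _ hij, uu_of_ne _ hne]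
  rfl

theorem dd_glue (v : T.vertices) {i j k : ι} (hi : i ∈ v.1) (hj : j ∈ v.1) (hk : k ∈ v.1)
    (hne : T.edge v i hi ≠ T.edge v j hj ∨ T.edge v i hi ≠ T.edge v k hk) :
    dd (glue T z).2 i j k = dd (z v).2 (T.edge v i hi) (T.edge v j hj) (T.edge v k hk) := by
  by_cases hij : i = j
  · subst hij; simp
  by_cases hik : i = k
  · subst hik
    rw [dd_mid _ hij, dd_mid _ (by simpa using hne)]
  by_cases hjk : j = k
  · subst hjk
    rw [dd_right _ hij, dd_right _ (by simpa using hne)]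
  have h3 : i ≠ j ∧ i ≠ k ∧ j ≠ k := ⟨hij, hik, hjk⟩
  have hv : T.join _ (nontrivial_triple (triple h3)) = v := by
    refine T.join_eq _ ?_ ?_
    · rintro a (rfl | rfl | rfl) <;> assumption
    · intro e he
      have ei := T.edge_eq hi (he (by simp))
      have ej := T.edge_eq hj (he (by simp))
      have ek := T.edge_eq hk (he (by simp))
      rw [ei, ej, ek] at hne
      simp at hne
  subst hv
  rw [dd_of_ne _ h3]
  rfl

/-! ### Gluing configurations -/

open Classical in
/-- The position of the label `i` in the configuration at the vertex `w`. -/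
def vertexPos (y : ∀ v : T.vertices, Conf V (T.Edges v)) (w : T.vertices) (i : ι) : V :=
  if h : i ∈ w.1 then (y w).1 (T.edge w i h) else 0

open Classical in
/-- The superposition of the configurations at the vertices, scaled by powers of `ε`. -/
def blowdown (y : ∀ v : T.vertices, Conf V (T.Edges v)) (ε : ℝ) (i : ι) : V :=
  -- The size of the complement grows strictly as a vertex shrinks, so for small ε each vertex
  -- dominates all vertices inside it.
  ∑ w ∈ (Set.toFinite (Set.univ : Set T.vertices)).toFinset,
    ε ^ (w.1ᶜ).ncard • vertexPos T y w i

variable (y : ∀ v : T.vertices, Conf V (T.Edges v))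

/-- Seen at the scale of v, a vertex strictly containing v or disjoint from it gives i and j the
same position and cancels, while a vertex strictly inside v keeps a positive power of the scale and
tends to 0. Only v itself survives. -/
theorem tendsto_blowdown (v : T.vertices) {i j : ι} (hi : i ∈ v.1) (hj : j ∈ v.1) :
    Tendsto (fun N : ℕ => (((N : ℝ) + 1)⁻¹ ^ (v.1ᶜ).ncard)⁻¹ •
        (blowdown T y ((N : ℝ) + 1)⁻¹ i - blowdown T y ((N : ℝ) + 1)⁻¹ j)) atTop
      (𝓝 ((y v).1 (T.edge v i hi) - (y v).1 (T.edge v j hj))) := by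
  classical
  have e1 : (y v).1 (T.edge v i hi) - (y v).1 (T.edge v j hj) =
      ∑ w ∈ (Set.toFinite (Set.univ : Set T.vertices)).toFinset,
        if w = v then vertexPos T y v i - vertexPos T y v j else 0 := by
    simp [vertexPos, hi, hj]
  rw [e1]
  simp only [blowdown, ← Finset.sum_sub_distrib, Finset.smul_sum]
  refine tendsto_finsetSum _ fun w _ => ?_
  have hε : ∀ N : ℕ, ((N : ℝ) + 1)⁻¹ ≠ 0 := fun N => by positivity
  split_ifs with hw
  · subst hw
    refine tendsto_const_nhds.congr fun N => ?_
    rw [← smul_sub, smul_smul, inv_mul_cancel₀ (pow_ne_zero _ (hε N)), one_smul]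
  · have hz : vertexPos T y w i = vertexPos T y w j ∨ w.1 ⊂ v.1 := by
      rcases T.nested _ v.2 _ w.2 with h | h | h
      · left
        have hs : v.1 ⊂ w.1 := h.ssubset_of_ne fun h => hw (Subtype.ext h.symm)
        have : T.edge w j (h hj) = T.edge w i (h hi) :=
          T.edge_eq _ (T.subset_edge v.2 hs hi (h hi) hj)
        simp [vertexPos, h hi, h hj, this]
      · exact Or.inr (h.ssubset_of_ne fun h => hw (Subtype.ext h))
      · left
        have h1 := Set.disjoint_left.1 h hi
        have h2 := Set.disjoint_left.1 h hj
        simp [vertexPos, h1, h2]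
    rcases hz with hz | hz
    · simp [hz]
    · have hlt : (v.1ᶜ).ncard < (w.1ᶜ).ncard :=
        Set.ncard_lt_ncard (compl_lt_compl_iff_lt.2 hz) (Set.toFinite _)
      obtain ⟨m, hm⟩ := Nat.exists_eq_add_of_lt hlt
      have h0 : Tendsto (fun N : ℕ => ((N : ℝ) + 1)⁻¹) atTop (𝓝 0) := by
        simpa using tendsto_one_div_add_atTop_nhds_zero_nat (𝕜 := ℝ)
      have h1 := ((h0.pow (m + 1)).smul_const (vertexPos T y w i - vertexPos T y w j))
      rw [zero_pow (Nat.succ_ne_zero m), zero_smul] at h1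
      refine h1.congr fun N => ?_
      rw [← smul_sub, smul_smul, hm, add_assoc, pow_add _ _ (m + 1), ← mul_assoc,
        inv_mul_cancel₀ (pow_ne_zero _ (hε N)), one_mul]

theorem eventually_injective_blowdown :
    ∀ᶠ N : ℕ in atTop, Function.Injective (blowdown T y ((N : ℝ) + 1)⁻¹) := by
  have : ∀ i j : ι, i ≠ j → ∀ᶠ N : ℕ in atTop,
      blowdown T y ((N : ℝ) + 1)⁻¹ i ≠ blowdown T y ((N : ℝ) + 1)⁻¹ j := by
    intro i j hij
    have hne := edge_join_ne T (pair hij)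
    have ht := tendsto_blowdown T y (T.join _ (nontrivial_pair (pair hij)))
      (T.subset_join (nontrivial_pair (pair hij)) (a := i) (by simp))
      (T.subset_join (nontrivial_pair (pair hij)) (a := j) (by simp))
    have := ht.eventually_ne (conf_sub_ne (y _) hne)
    filter_upwards [this] with N hN h
    simp [h] at hN
  filter_upwards [eventually_all.2 fun i => eventually_all.2 fun j => eventually_imp_distrib_left.2
    (this i j)] with N hN i j h
  by_contra hij
  exact hN i j hij h

/-- The superposed configurations converge to the glued point: each pair or triple of labels is read
off at the scale of its join, where its labels do not all coincide. -/
theorem glue_conf_mem : glue T (fun v => (dir (y v), ratio (y v))) ∈ cbarSet V ι := by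
  classical
  rw [cbarSet_eq]
  have hinj := eventually_injective_blowdown T y
  obtain ⟨N0, hN0⟩ := hinj.exists
  let c : ℕ → Conf V ι := fun N =>
    -- Injectivity holds only eventually; the other terms are replaced by a fixed configuration,
    -- which does not affect the limit.
    if h : Function.Injective (blowdown T y ((N : ℝ) + 1)⁻¹) then ⟨_, h⟩ else ⟨_, hN0⟩
  have hc : ∀ (v : T.vertices) {i j : ι} (hi : i ∈ v.1) (hj : j ∈ v.1),
      Tendsto (fun N : ℕ => (((N : ℝ) + 1)⁻¹ ^ (v.1ᶜ).ncard)⁻¹ • ((c N).1 i - (c N).1 j)) atTop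
      (𝓝 ((y v).1 (T.edge v i hi) - (y v).1 (T.edge v j hj))) := by
    intro v i j hi hj
    refine (tendsto_blowdown T y v hi hj).congr' ?_
    filter_upwards [hinj] with N hN
    simp [c, hN]
  have hr : ∀ (v : T.vertices) (N : ℕ), 0 < (((N : ℝ) + 1)⁻¹ ^ (v.1ᶜ).ncard)⁻¹ :=
    fun v N => by positivity
  refine mem_closure_of_tendsto (b := atTop) (f := fun N => (dir (c N), ratio (c N))) ?_
    (Eventually.of_forall fun N => ⟨c N, rfl⟩)
  refine Tendsto.prodMk_nhds (tendsto_pi_nhds.2 fun p => tendsto_subtype_rng.2 ?_)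
    (tendsto_pi_nhds.2 fun t => ?_)
  · have hne := edge_join_ne T p
    have := tendsto_uu c _ (hr _) (hc _ (T.subset_join (nontrivial_pair p) (a := p 0) (by simp))
      (T.subset_join (nontrivial_pair p) (a := p 1) (by simp))) (conf_sub_ne (y _) hne)
    rw [← uu_dir, ← uu_glue T (fun v => (dir (y v), ratio (y v))) _ _ _ hne, uu_pair] at this
    simp only [uu_pair] at this
    exact this
  · have hne := edge_join_ne_triple T t
    have := tendsto_dd c _ (hr _) (hc _ (T.subset_join (nontrivial_triple t) (a := t 0) (by simp))
      (T.subset_join (nontrivial_triple t) (a := t 1) (by simp)))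
      (hc _ (T.subset_join (nontrivial_triple t) (a := t 0) (by simp))
      (T.subset_join (nontrivial_triple t) (a := t 2) (by simp)))
      (hne.imp (conf_sub_ne (y _)) (conf_sub_ne (y _)))
    rw [← dd_ratio _ hne, ← dd_glue T (fun v => (dir (y v), ratio (y v))) _ _ _ _ hne,
      dd_triple] at this
    simp only [dd_triple] at this
    exact this

theorem insert_excludes_glue (v : T.vertices) {i k : ι} (hi : i ∈ v.1) (hk : k ∈ v.1)
    (hne : T.edge v i hi ≠ T.edge v k hk) :
    insert i {j | Excludes ⟨_, glue_conf_mem T y⟩ i j k} = (T.edge v i hi).1 := by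
  have hik : i ≠ k := by rintro rfl; exact hne rfl
  ext a
  rw [mem_insert_excludes_iff _ hik]
  by_cases ha : a ∈ v.1
  · rw [dd_glue T _ v hi ha hk (Or.inr hne), dd_ratio _ (Or.inr hne)]
    constructor
    · intro h
      have := (y v).2 (enorm_div_eq_zero h)
      rw [this]; exact T.mem_edge v ha
    · intro h
      rw [T.edge_eq ha h]; simp
  -- For a outside v, the labels i and k lie over one edge of the join of i, a, k and a lies over
  -- another, so the ratio is ∞ instead of 0.
  · refine iff_of_false ?_ fun h => ha (T.edge_subset _ h)
    have hs : ({i, a, k} : Set ι).Nontrivial := ⟨i, by simp, k, by simp, hik⟩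
    have hw := T.subset_join hs
    have hw' := T.not_subset_edge_join hs
    set w := T.join _ hs
    have hiw : i ∈ w.1 := hw (by simp)
    have haw : a ∈ w.1 := hw (by simp)
    have hkw : k ∈ w.1 := hw (by simp)
    have hvw : v.1 ⊂ w.1 := by
      rcases T.nested _ v.2 _ w.2 with h | h | h
      · exact h.ssubset_of_ne fun h => ha (h ▸ haw)
      · exact absurd (h haw) ha
      · exact absurd hiw (Set.disjoint_left.1 h hi)
    have hsub := T.subset_edge v.2 hvw hi hiw
    have hek : T.edge w k hkw = T.edge w i hiw := T.edge_eq _ (hsub hk)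
    have hea : T.edge w i hiw ≠ T.edge w a haw := by
      intro h
      refine hw' (T.edge w i hiw) ?_
      rintro b (rfl | rfl | rfl)
      · exact T.mem_edge _ _
      · rw [h]; exact T.mem_edge _ _
      · exact hsub hk
    rw [dd_glue T _ w hiw haw hkw (Or.inl hea), hek, dd_mid _ hea]
    simp

theorem glue_conf_mem_stratum : (⟨_, glue_conf_mem T y⟩ : CBar V ι) ∈ stratum V T := by
  change treeVertices _ = T.vertices
  ext A
  constructor
  · rintro (⟨i, k, ⟨j, hj⟩, rfl⟩ | ⟨rfl, h⟩)
    · have hj' := (excludes_iff _ _ _ _).1 hj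
      have hik := hj'.1.2.1
      have hne := edge_join_ne T (pair hik)
      have := insert_excludes_glue T y (T.join _ (nontrivial_pair (pair hik)))
        (T.subset_join _ (by simp)) (T.subset_join _ (by simp)) hne
      change insert i {j | Excludes ⟨_, glue_conf_mem T y⟩ i j k} = _ at this
      rw [this]
      refine T.edge_mem_vertices _ ?_
      rw [← this]
      exact ⟨i, by simp, j, by simp [hj], hj'.1.1⟩
    · exact T.univ_mem h
  · intro hA
    by_cases hu : A = Set.univ
    · exact Or.inr ⟨hu, T.nontrivial _ hA⟩
    · left
      obtain ⟨v, hv⟩ := T.exists_parent hA hu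
      obtain ⟨i, hi, j, hj, hij⟩ := T.nontrivial _ hA
      obtain ⟨k, hk, hkA⟩ := Set.exists_of_ssubset hv.2.1
      have hiv := hv.2.1.subset hi
      have ei : T.edge v i hiv = ⟨A, hv⟩ := T.edge_eq _ hi
      have hne : T.edge v i hiv ≠ T.edge v k hk := by
        rw [ei]
        intro h
        have := T.mem_edge v hk
        rw [← h] at this
        exact hkA this
      have := insert_excludes_glue T y v hiv hk hne
      rw [ei] at this
      refine ⟨i, k, ⟨j, ?_⟩, this.symm⟩
      have hj' : j ∈ insert i {j | Excludes ⟨_, glue_conf_mem T y⟩ i j k} := by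
        rw [this]; exact hj
      exact hj'.resolve_left hij.symm

/-- Gluing is continuous and sends families of configurations, which are dense, into the open
stratum. -/
theorem glue_mem (hz : ∀ v, z v ∈ cbarSet V (T.Edges v)) :
    ∃ h : glue T z ∈ cbarSet V ι, (⟨_, h⟩ : CBar V ι) ∈ closedStratum V T := by
  have h1 : z ∈ closure (Set.univ.pi fun v : T.vertices =>
      Set.range fun c : Conf V (T.Edges v) => (dir c, ratio c)) := by
    rw [closure_pi_set]
    intro v _
    have := hz v
    rw [cbarSet_eq] at this
    exact this
  have h2 : glue T z ∈ closure (Subtype.val '' stratum V T) := by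
    refine map_mem_closure (continuous_glue T) h1 fun w hw => ?_
    choose c hc using fun v => hw v (Set.mem_univ v)
    have : w = fun v => (dir (c v), ratio (c v)) := funext fun v => (hc v).symm
    subst this
    exact ⟨_, glue_conf_mem_stratum T c, rfl⟩
  have h3 : glue T z ∈ cbarSet V ι :=
    closure_minimal (by rintro _ ⟨x, -, rfl⟩; exact x.2) isClosed_closure h2
  exact ⟨h3, closure_subtype.2 h2⟩

/-- Every family of points at the vertices of a tree comes from a point of the closed stratum. -/
theorem exists_vertexCoords_eq (z : ∀ v : T.vertices, CBar V (T.Edges v)) :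
    ∃ x ∈ closedStratum V T, ∀ v, vertexCoords T x v = z v := by
  obtain ⟨h, hx⟩ := glue_mem T (fun v => (z v).1) fun v => (z v).2
  refine ⟨_, hx, fun v => Subtype.ext (Prod.ext ?_ ?_)⟩
  · refine dirs_ext fun e f hef => ?_
    rw [vertexCoords, uu_restrict]
    have := uu_glue T (fun v => (z v).1) v (T.leaf_mem_vertex v e) (T.leaf_mem_vertex v f)
      (by simpa only [edge_leaf] using hef)
    simpa only [edge_leaf] using this
  · refine ratios_ext fun e f g hef heg hfg => ?_
    rw [vertexCoords, dd_restrict]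
    have := dd_glue T (fun v => (z v).1) v (T.leaf_mem_vertex v e) (T.leaf_mem_vertex v f)
      (T.leaf_mem_vertex v g) (by simpa only [edge_leaf] using Or.inl hef)
    simpa only [edge_leaf] using this

/-! ### Points determined by their coordinates at the vertices -/

variable [FiniteDimensional ℝ V] {T} {x : CBar V ι}

theorem cluster_edge (hx : ∀ A ∈ T.vertices, Cluster x A) (v : T.vertices) (e : T.Edges v) :
    Cluster x e.1 := by
  rcases e.2.1 with h | ⟨i, hi⟩
  · exact hx _ h
  · rw [hi]
    rintro a rfl b rfl c -
    simp

theorem not_mem_edge_of_ne {v : T.vertices} {i j : ι} {hi : i ∈ v.1} {hj : j ∈ v.1}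
    (h : T.edge v i hi ≠ T.edge v j hj) : j ∉ (T.edge v i hi).1 :=
  fun h' => h (T.edge_eq hj h').symm

/-- At the largest scale of the four labels each edge is a cluster and contracts to a point, and the
two points differ. Thus the coordinates at a vertex do not depend on the chosen leaves. -/
theorem uu_congr_edge (hx : ∀ A ∈ T.vertices, Cluster x A) (v : T.vertices) {i j i' j' : ι}
    (hi : i ∈ v.1) (hj : j ∈ v.1) (hi' : i' ∈ (T.edge v i hi).1) (hj' : j' ∈ (T.edge v j hj).1)
    (hne : T.edge v i hi ≠ T.edge v j hj) : uu x.1.1 i j = uu x.1.1 i' j' := by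
  have hij : i ≠ j := by rintro rfl; exact hne rfl
  obtain ⟨p, hp, hu, hd⟩ := exists_top x {i, j, i', j'} (by simp) ⟨i, by simp, j, by simp, hij⟩
  have e1 : p i = p i' := (cluster_edge hx v (T.edge v i hi)).eq_of_top hd (T.mem_edge v hi) hi'
    (not_mem_edge_of_ne hne) (by simp) (by simp) (by simp)
  have e2 : p j = p j' := (cluster_edge hx v (T.edge v j hj)).eq_of_top hd (T.mem_edge v hj) hj'
    (not_mem_edge_of_ne hne.symm) (by simp) (by simp) (by simp)
  have e3 : p i ≠ p j := by
    intro h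
    obtain ⟨l, hl, hl'⟩ := hp i (by simp)
    simp only [Set.mem_insert_iff, Set.mem_singleton_iff] at hl
    rcases hl with rfl | rfl | rfl | rfl <;> simp_all
  rw [hu i (by simp) j (by simp) e3, hu i' (by simp) j' (by simp) (e1 ▸ e2 ▸ e3), e1, e2]

theorem dd_congr_edge (hx : ∀ A ∈ T.vertices, Cluster x A) (v : T.vertices) {i j k i' j' k' : ι}
    (hi : i ∈ v.1) (hj : j ∈ v.1) (hk : k ∈ v.1) (hi' : i' ∈ (T.edge v i hi).1)
    (hj' : j' ∈ (T.edge v j hj).1) (hk' : k' ∈ (T.edge v k hk).1)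
    (hne : T.edge v i hi ≠ T.edge v j hj ∨ T.edge v i hi ≠ T.edge v k hk) :
    dd x.1.2 i j k = dd x.1.2 i' j' k' := by
  have hij : i ≠ j ∨ i ≠ k := by
    by_contra hcon
    push Not at hcon
    obtain ⟨rfl, rfl⟩ := hcon
    simp at hne
  obtain ⟨p, hp, hu, hd⟩ := exists_top x {i, j, k, i', j', k'} (by simp) (by
    rcases hij with h | h
    · exact ⟨i, by simp, j, by simp, h⟩
    · exact ⟨i, by simp, k, by simp, h⟩)
  have key : ∀ a b : ι, a ∈ ({i, j, k, i', j', k'} : Set ι) → b ∈ ({i, j, k, i', j', k'} : Set ι) →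
      ∀ ha : a ∈ v.1, b ∈ (T.edge v a ha).1 → p a = p b := by
    intro a b has hbs ha hb
    -- An edge contracts only if some label under consideration lies outside it; one does because i,
    -- j, k are not all over the same edge.
    have hout : ∃ c ∈ ({i, j, k, i', j', k'} : Set ι), c ∉ (T.edge v a ha).1 := by
      by_contra hcon
      push Not at hcon
      have h1 : T.edge v i hi = T.edge v a ha := T.edge_eq _ (hcon i (by simp))
      have h2 : T.edge v j hj = T.edge v a ha := T.edge_eq _ (hcon j (by simp))
      have h3 : T.edge v k hk = T.edge v a ha := T.edge_eq _ (hcon k (by simp))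
      simp [h1, h2, h3] at hne
    obtain ⟨c, hcs, hc⟩ := hout
    exact (cluster_edge hx v _).eq_of_top hd (T.mem_edge v ha) hb hc has hbs hcs
  have e1 := key i i' (by simp) (by simp) hi hi'
  have e2 := key j j' (by simp) (by simp) hj hj'
  have e3 := key k k' (by simp) (by simp) hk hk'
  have hn : p i ≠ p j ∨ p i ≠ p k := by
    by_contra hcon
    push Not at hcon
    obtain ⟨l, hl, hl'⟩ := hp i (by simp)
    simp only [Set.mem_insert_iff, Set.mem_singleton_iff] at hl
    refine hl' ?_
    rcases hl with h | h | h | h | h | h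
    · rw [h]
    · rw [h, hcon.1]
    · rw [h, hcon.2]
    · rw [h, e1]
    · rw [h, ← e2, hcon.1]
    · rw [h, ← e3, hcon.2]
  rw [hd i (by simp) j (by simp) k (by simp) hn,
    hd i' (by simp) j' (by simp) k' (by simp) (by rwa [← e1, ← e2, ← e3]), e1, e2, e3]

theorem glue_vertexCoords (hx : ∀ A ∈ T.vertices, Cluster x A) :
    glue T (fun v => (vertexCoords T x v).1) = x.1 := by
  refine Prod.ext (funext fun p => Subtype.ext ?_) (funext fun t => ?_)
  · have h0 : p 0 ∈ (T.join _ (nontrivial_pair p)).1 := T.subset_join _ (by simp)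
    have h1 : p 1 ∈ (T.join _ (nontrivial_pair p)).1 := T.subset_join _ (by simp)
    have hne := edge_join_ne T p
    rw [← uu_pair, ← uu_pair, uu_glue T _ _ h0 h1 hne, vertexCoords, uu_restrict]
    exact (uu_congr_edge hx _ h0 h1 (T.leaf_mem _ _) (T.leaf_mem _ _) hne).symm
  · have h0 : t 0 ∈ (T.join _ (nontrivial_triple t)).1 := T.subset_join _ (by simp)
    have h1 : t 1 ∈ (T.join _ (nontrivial_triple t)).1 := T.subset_join _ (by simp)
    have h2 : t 2 ∈ (T.join _ (nontrivial_triple t)).1 := T.subset_join _ (by simp)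
    have hne := edge_join_ne_triple T t
    rw [← dd_triple x.1.2, ← dd_triple (glue _ _).2, dd_glue T _ _ h0 h1 h2 hne, vertexCoords, dd_restrict]
    exact (dd_congr_edge hx _ h0 h1 h2 (T.leaf_mem _ _) (T.leaf_mem _ _) (T.leaf_mem _ _) hne).symm

/-- Cluster conditions are closed and hold on the stratum. Conversely, a point satisfying them is
glued from its own coordinates, hence is a limit of points of the stratum. -/
theorem mem_closedStratum_iff {x : CBar V ι} :
    x ∈ closedStratum V T ↔ ∀ A ∈ T.vertices, Cluster x A := by
  refine ⟨fun h A => cluster_of_mem_closedStratum h, fun h => ?_⟩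
  obtain ⟨h1, h2⟩ := glue_mem T (fun v => (vertexCoords T x v).1) fun v => (vertexCoords T x v).2
  have : x = ⟨_, h1⟩ := Subtype.ext (glue_vertexCoords h).symm
  rw [this]; exact h2

theorem eq_of_vertexCoords_eq {y : CBar V ι} (hx : x ∈ closedStratum V T)
    (hy : y ∈ closedStratum V T) (h : ∀ v, vertexCoords T x v = vertexCoords T y v) : x = y := by
  apply Subtype.ext
  rw [← glue_vertexCoords (mem_closedStratum_iff.1 hx),
    ← glue_vertexCoords (mem_closedStratum_iff.1 hy)]
  simp only [h]

end Glue

/-! ### Directions along a line -/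

section Directions

variable {V : Type} [NormedAddCommGroup V] [NormedSpace ℝ V] {ι : Type}

/-- The vector `w` is `v` or `-v`. -/
def Along (v w : V) : Prop := w = v ∨ w = -v

theorem Along.neg {v w : V} (h : Along v w) : Along v (-w) := by
  rcases h with rfl | rfl
  · exact Or.inr rfl
  · exact Or.inl (neg_neg v)

theorem along_of_eq_smul {v w : V} (hv : ‖v‖ = 1) (hw : ‖w‖ = 1) {r : ℝ} (h : w = r • v) :
    Along v w := by
  have : |r| = 1 := by rw [h, norm_smul, hv, mul_one] at hw; exact hw
  rcases eq_or_eq_neg_of_abs_eq this with rfl | rfl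
  · left; simpa using h
  · right; simpa using h

theorem norm_smul_normalize {q : V} (hq : q ≠ 0) : ‖q‖ • (‖q‖⁻¹ • q) = q := by
  rw [smul_smul, mul_inv_cancel₀ (norm_ne_zero_iff.2 hq), one_smul]

theorem norm_normalize {q : V} (hq : q ≠ 0) : ‖‖q‖⁻¹ • q‖ = 1 := by
  rw [norm_smul, norm_inv, norm_norm, inv_mul_cancel₀ (norm_ne_zero_iff.2 hq)]

theorem Along.eq_smul {v q : V} (hq : q ≠ 0) (h : Along v (‖q‖⁻¹ • q)) : ∃ r : ℝ, q = r • v := by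
  rcases h with h | h
  · exact ⟨‖q‖, by rw [← h, norm_smul_normalize hq]⟩
  · exact ⟨-‖q‖, by rw [neg_smul, ← smul_neg, ← h, norm_smul_normalize hq]⟩

variable [FiniteDimensional ℝ V]

theorem uu_symm (x : CBar V ι) (i j : ι) : uu x.1.1 j i = -uu x.1.1 i j := by
  by_cases h : i = j
  · simp [h]
  obtain ⟨p, hp, hu, -⟩ := exists_top x {i, j} (by simp) ⟨i, by simp, j, by simp, h⟩
  have hne : p i ≠ p j := by
    intro e
    obtain ⟨l, rfl | rfl, hl⟩ := hp i (by simp) <;> simp_all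
  rw [hu i (by simp) j (by simp) hne, hu j (by simp) i (by simp) hne.symm, ← neg_sub (p i),
    norm_neg, smul_neg]

/-- Suppose a and b are apart at the largest scale of the three labels. If c coincides with one of
them, the direction from a to b is one of the given directions up to sign; otherwise the difference
of a and b is a multiple of v. Both are excluded. -/
theorem dd_eq_zero_of_along {x : CBar V ι} {v : V} (hv : ‖v‖ = 1) {a b c : ι} (hac : a ≠ c)
    (hbc : b ≠ c) (h1 : Along v (uu x.1.1 a c)) (h2 : Along v (uu x.1.1 b c))
    (h3 : ¬ Along v (uu x.1.1 a b)) : dd x.1.2 a b c = 0 := by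
  by_cases hab' : a = b
  · simp [hab']
  obtain ⟨p, hp, hu, hd⟩ := exists_top x {a, b, c} (by simp) ⟨a, by simp, c, by simp, hac⟩
  by_contra hne
  have hab : p a ≠ p b := fun h => by
    by_cases hc : p a = p c
    · obtain ⟨l, rfl | rfl | rfl, hl⟩ := hp a (by simp) <;> simp_all
    · exact hne (by rw [hd a (by simp) b (by simp) c (by simp) (Or.inr hc), h]; simp)
  have huab := hu a (by simp) b (by simp) hab
  by_cases hb : p b = p c
  · rw [hu a (by simp) c (by simp) (hb ▸ hab), ← hb, ← huab] at h1
    exact h3 h1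
  by_cases ha : p a = p c
  · rw [hu b (by simp) c (by simp) hb, ← ha, ← hu b (by simp) a (by simp) hab.symm,
      uu_symm x a b] at h2
    exact h3 (by simpa using h2.neg)
  rw [hu a (by simp) c (by simp) ha] at h1
  rw [hu b (by simp) c (by simp) hb] at h2
  obtain ⟨r, hr⟩ := h1.eq_smul (sub_ne_zero.2 ha)
  obtain ⟨s, hs⟩ := h2.eq_smul (sub_ne_zero.2 hb)
  refine h3 (along_of_eq_smul hv (norm_uu _ hab') (r := ‖p a - p b‖⁻¹ * (r - s)) ?_)
  rw [huab, mul_smul, sub_smul, ← hr, ← hs, sub_sub_sub_cancel_right]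

/-- The labels joined to `i` by a chain of pairs whose directions are not along `v`. -/
def component (x : CBar V ι) (v : V) (i : ι) : Set ι :=
  {l | Relation.ReflTransGen (fun a b => a ≠ b ∧ ¬ Along v (uu x.1.1 a b)) i l}

/-- A label c outside the component is seen along v from all of its members, so every link of a
chain is infinitely short relative to c, and links compose by `dd_zero_trans`. -/
theorem cluster_component (x : CBar V ι) {v : V} (hv : ‖v‖ = 1) (i : ι) :
    Cluster x (component x v i) := by
  intro a ha b hb c hc
  have hsymm : Std.Symm fun a b => a ≠ b ∧ ¬ Along v (uu x.1.1 a b) :=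
    ⟨fun a b h => ⟨h.1.symm, fun h' => h.2 (by simpa [uu_symm x b a] using h'.neg)⟩⟩
  have hab := (Relation.ReflTransGen.stdSymm.symm _ _ ha).trans hb
  have hout : ∀ d, d ∈ component x v i → d ≠ c ∧ Along v (uu x.1.1 d c) := by
    intro d hd
    have hdc : d ≠ c := by rintro rfl; exact hc hd
    refine ⟨hdc, ?_⟩
    by_contra h
    exact hc (Relation.ReflTransGen.tail hd ⟨hdc, h⟩)
  have hac := (hout a ha).1
  clear hb
  induction hab with
  | refl => simp
  | @tail d e had hde ih =>
    have hd : d ∈ component x v i := Relation.ReflTransGen.trans ha had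
    have he : e ∈ component x v i := Relation.ReflTransGen.tail hd hde
    exact dd_zero_trans hac ih (dd_eq_zero_of_along hv (hout d hd).1 (hout e he).1 (hout d hd).2
      (hout e he).2 hde.2)

/-! ### Configurations determined by their directions -/

/-- The points `a`, `b`, `c` are not on a line. -/
def Triangle (a b c : V) : Prop := ∀ r s : ℝ, r • (a - b) + s • (a - c) = 0 → r = 0 ∧ s = 0

/-- All the points `p i` are on a line. -/
def OnLine (p : ι → V) : Prop := ∃ v : V, ∀ i j, ∃ r : ℝ, p i - p j = r • v

theorem exists_triangle {p : ι → V} (hp : ¬ OnLine p) {i k : ι} (hik : p i ≠ p k) :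
    ∃ l, Triangle (p i) (p k) (p l) := by
  by_contra hcon
  push Not at hcon
  have key : ∀ l, ∃ r : ℝ, p i - p l = r • (p i - p k) := by
    intro l
    have := hcon l
    unfold Triangle at this
    push Not at this
    obtain ⟨r, s, h, hrs⟩ := this
    have hs : s ≠ 0 := by
      rintro rfl
      simp only [zero_smul, add_zero, smul_eq_zero, sub_eq_zero, hik, or_false] at h
      exact hrs h rfl
    refine ⟨-(s⁻¹ * r), ?_⟩
    have : s • (p i - p l) = -(r • (p i - p k)) := by
      rw [eq_neg_iff_add_eq_zero, add_comm]; exact h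
    rw [neg_smul, mul_smul, ← smul_neg, ← this, smul_smul, inv_mul_cancel₀ hs, one_smul]
  refine hp ⟨p i - p k, fun a b => ?_⟩
  obtain ⟨r, hr⟩ := key a
  obtain ⟨s, hs⟩ := key b
  exact ⟨s - r, by rw [sub_smul, ← hr, ← hs]; abel⟩

theorem Triangle.ne {a b c : V} (h : Triangle a b c) : a ≠ b ∧ a ≠ c ∧ b ≠ c := by
  refine ⟨?_, ?_, ?_⟩
  · rintro rfl; simpa using h 1 0 (by simp)
  · rintro rfl; simpa using h 0 1 (by simp)
  · rintro rfl; simpa using h 1 (-1) (by simp)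

/-- The sides of a triangle have different directions. -/
theorem Triangle.directions {a b c : V} (h : Triangle a b c) {w w' w'' : V}
    (hw : w = ‖a - b‖⁻¹ • (a - b)) (hw' : w' = ‖a - c‖⁻¹ • (a - c))
    (hw'' : w'' = ‖b - c‖⁻¹ • (b - c)) :
    (∀ r s : ℝ, r • w + s • w' = 0 → r = 0 ∧ s = 0) ∧ w' ≠ w'' ∧ w ≠ -w'' := by
  obtain ⟨h1, h2, h3⟩ := h.ne
  have n1 : ‖a - b‖⁻¹ ≠ 0 := inv_ne_zero (norm_ne_zero_iff.2 (sub_ne_zero.2 h1))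
  have n2 : ‖a - c‖⁻¹ ≠ 0 := inv_ne_zero (norm_ne_zero_iff.2 (sub_ne_zero.2 h2))
  have n3 : ‖b - c‖⁻¹ ≠ 0 := inv_ne_zero (norm_ne_zero_iff.2 (sub_ne_zero.2 h3))
  have hbc : b - c = (a - c) - (a - b) := by abel
  refine ⟨fun r s hrs => ?_, fun e => ?_, fun e => ?_⟩
  · rw [hw, hw', smul_smul, smul_smul] at hrs
    have := h _ _ hrs
    simpa [n1, n2, sub_eq_zero, h1, h2] using this
  · rw [hw', hw''] at e
    -- Writing b - c = (a - c) - (a - b) in the equality of directions gives a linear relation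
    -- between two sides with a nonzero coefficient.
    have : ‖b - c‖⁻¹ • (a - b) + (‖a - c‖⁻¹ - ‖b - c‖⁻¹) • (a - c) = 0 := by
      rw [sub_smul, e, ← smul_sub, ← smul_add, hbc, sub_sub_cancel_left, add_neg_cancel, smul_zero]
    exact n3 (h _ _ this).1
  · rw [hw, hw''] at e
    have : (‖a - b‖⁻¹ - ‖b - c‖⁻¹) • (a - b) + ‖b - c‖⁻¹ • (a - c) = 0 := by
      rw [sub_smul, e, ← smul_neg, ← smul_sub, ← smul_add, hbc, neg_sub, sub_sub_cancel_left,
        neg_add_cancel, smul_zero]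
    exact n3 (h _ _ this).2

/-- `p` is the configuration formed at the largest scale of the point `x`. -/
structure IsTop (x : CBar V ι) (s : Set ι) (p : ι → V) : Prop where
  exists_ne : ∀ a ∈ s, ∃ i ∈ s, p i ≠ p a
  uu_eq : ∀ i ∈ s, ∀ j ∈ s, p i ≠ p j → uu x.1.1 i j = ‖p i - p j‖⁻¹ • (p i - p j)
  dd_eq : ∀ i ∈ s, ∀ j ∈ s, ∀ k ∈ s, p i ≠ p j ∨ p i ≠ p k →
    dd x.1.2 i j k = ‖p i - p j‖ₑ / ‖p i - p k‖ₑ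

theorem exists_isTop (x : CBar V ι) (s : Set ι) (hf : s.Finite) (hs : s.Nontrivial) :
    ∃ p, IsTop x s p := by
  obtain ⟨p, h1, h2, h3⟩ := exists_top x s hf hs
  exact ⟨p, h1, h2, h3⟩

variable {x y : CBar V ι}

theorem IsTop.cluster {p : ι → V} (hp : IsTop x Set.univ p) (a : ι) :
    Cluster x {j | p j = p a} := by
  intro i hi j hj k hk
  have hik : p i ≠ p k := fun h => hk (h.symm.trans hi)
  have hij : p i = p j := Eq.trans hi (Eq.symm hj)
  rw [hp.dd_eq i trivial j trivial k trivial (Or.inr hik), hij]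
  simp

/-- Labels which coincide at the largest scale of `x` are infinitely close to each other in
every point with the same directions, unless the largest scale is collinear. -/
theorem IsTop.cluster_of_dirs_eq {p : ι → V} (hp : IsTop x Set.univ p) (hline : ¬ OnLine p)
    (hxy : x.1.1 = y.1.1) (a : ι) : Cluster y {j | p j = p a} := by
  intro i hi j hj k hk
  by_cases hij : i = j
  · simp [hij]
  have hik : p i ≠ p k := fun h => hk (h.symm.trans hi)
  have hpij : p j = p i := Eq.trans hj (Eq.symm hi)
  obtain ⟨l, hl⟩ := exists_triangle hline hik
  obtain ⟨-, hil, hkl⟩ := hl.ne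
  have uik := hp.uu_eq i trivial k trivial hik
  have uil := hp.uu_eq i trivial l trivial hil
  have ukl := hp.uu_eq k trivial l trivial hkl
  have ujk := hp.uu_eq j trivial k trivial (hpij ▸ hik)
  have ujl := hp.uu_eq j trivial l trivial (hpij ▸ hil)
  rw [hpij, ← uik] at ujk
  rw [hpij, ← uil] at ujl
  obtain ⟨hind, h1, h2⟩ := hl.directions uik uil ukl
  have h0 : uu x.1.1 i k ≠ uu x.1.1 i l := fun e => by
    simpa using hind 1 (-1) (by simp [e])
  rw [hxy] at *
  obtain ⟨q, hq⟩ := exists_isTop y {i, j, k, l} (by simp) ⟨i, by simp, j, by simp, hij⟩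
  have U : ∀ a ∈ ({i, j, k, l} : Set ι), ∀ b ∈ ({i, j, k, l} : Set ι), q a ≠ q b →
      uu y.1.1 a b = ‖q a - q b‖⁻¹ • (q a - q b) := hq.uu_eq
  have mi : i ∈ ({i, j, k, l} : Set ι) := by simp
  have mj : j ∈ ({i, j, k, l} : Set ι) := by simp
  have mk : k ∈ ({i, j, k, l} : Set ι) := by simp
  have ml : l ∈ ({i, j, k, l} : Set ι) := by simp
  -- If k and l coincided, whichever of i and j is apart from them would see both in the same
  -- direction, contrary to `h0`.
  have nkl : q k ≠ q l := by
    intro e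
    by_cases e' : q i = q k
    · have e'' : q j ≠ q i := by
        intro e''
        obtain ⟨b, hb, hb'⟩ := hq.exists_ne i mi
        refine hb' ?_
        rcases hb with rfl | rfl | rfl | rfl
        · rfl
        · exact e''
        · exact e'.symm
        · exact (e'.trans e).symm
      refine h0 ?_
      rw [← ujk, ← ujl, U j mj k mk (e' ▸ e''), U j mj l ml (e ▸ e' ▸ e''), e]
    · exact h0 (by rw [U i mi k mk e', U i mi l ml (e ▸ e'), e])
  have nil : q i ≠ q l := by
    intro e
    refine h2 ?_
    rw [U i mi k mk (e ▸ nkl.symm), ← uu_symm, U l ml k mk nkl.symm, e]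
  have nik : q i ≠ q k := fun e => h1 (by rw [U i mi l ml nil, U k mk l ml nkl, e])
  have njk : q j ≠ q k := fun e => h1 (by
    rw [← ujl, U j mj l ml (e ▸ nkl), U k mk l ml nkl, e])
  have njl : q j ≠ q l := by
    intro e
    refine h2 ?_
    rw [← ujk, U j mj k mk njk, ← uu_symm, U l ml k mk nkl.symm, e]
  have V1 := norm_smul_normalize (sub_ne_zero.2 nik)
  have V2 := norm_smul_normalize (sub_ne_zero.2 nil)
  have V3 := norm_smul_normalize (sub_ne_zero.2 njk)
  have V4 := norm_smul_normalize (sub_ne_zero.2 njl)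
  rw [← U i mi k mk nik] at V1
  rw [← U i mi l ml nil] at V2
  rw [← U j mj k mk njk, ujk] at V3
  rw [← U j mj l ml njl, ujl] at V4
  -- The difference of k and l, computed through i and through j, is a combination of the same two
  -- independent directions. The lengths therefore agree, and so do the positions of i and j.
  have := hind (‖q j - q k‖ - ‖q i - q k‖) (‖q i - q l‖ - ‖q j - q l‖) (by
    rw [sub_smul, sub_smul, V1, V2, V3, V4]; abel)
  have hqij : q i = q j := by
    rw [sub_eq_zero.1 this.1, V1] at V3
    exact sub_left_inj.1 V3
  rw [hq.dd_eq i mi j mj k mk (Or.inr nik), hqij]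
  simp

/-- Injective configurations which are not collinear are determined, up to translation and
scaling, by the directions between their points. -/
theorem ratios_eq_of_isTop {p q : ι → V} (hp : IsTop x Set.univ p) (hq : IsTop y Set.univ q)
    (hpi : Function.Injective p) (hqi : Function.Injective q) (hline : ¬ OnLine p)
    (hxy : x.1.1 = y.1.1) : x = y := by
  let c : ι → ι → ℝ := fun i j => ‖q i - q j‖ * ‖p i - p j‖⁻¹
  have hc : ∀ i j, q i - q j = c i j • (p i - p j) := by
    intro i j
    by_cases h : i = j
    · simp [h]
    · have h1 := hp.uu_eq i trivial j trivial (hpi.ne h)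
      rw [hxy, hq.uu_eq i trivial j trivial (hqi.ne h)] at h1
      rw [mul_smul, ← h1, norm_smul_normalize (sub_ne_zero.2 (hqi.ne h))]
  have htri : ∀ i j k, Triangle (p i) (p j) (p k) → c i j = c i k := by
    intro i j k h
    have e : q j - q k = (q i - q k) - (q i - q j) := by abel
    rw [hc, hc, hc] at e
    have := h (c i j - c j k) (c j k - c i k) (by
      have e' : p j - p k = (p i - p k) - (p i - p j) := by abel
      rw [e', smul_sub] at e
      rw [sub_smul, sub_smul]
      rw [← sub_eq_zero] at e
      rw [← e]; abel)
    linarith [this.1, this.2]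
  have hcc : ∀ i j k, i ≠ j → i ≠ k → j ≠ k → c i j = c i k := by
    intro i j k hij hik hjk
    by_cases h : Triangle (p i) (p j) (p k)
    · exact htri i j k h
    -- When i, j, k are on a line, their scale factors are compared through a label l off that line.
    obtain ⟨l, hl⟩ := exists_triangle hline (hpi.ne hij)
    unfold Triangle at h
    push Not at h
    obtain ⟨r, s, hrs, hrs'⟩ := h
    have hs : s ≠ 0 := by
      rintro rfl
      simp only [zero_smul, add_zero, smul_eq_zero, sub_eq_zero, hpi.ne hij, or_false] at hrs
      exact hrs' hrs rfl
    have hr : r ≠ 0 := by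
      rintro rfl
      simp only [zero_smul, zero_add, smul_eq_zero, sub_eq_zero, hpi.ne hik, or_false] at hrs
      exact hs hrs
    refine (htri i j l hl).trans (htri i k l fun r' s' h' => ?_).symm
    have e : s • (p i - p k) = -(r • (p i - p j)) := by
      rw [eq_neg_iff_add_eq_zero, add_comm]; exact hrs
    -- A relation between the sides from i to k and from i to l becomes, after multiplication by s,
    -- a relation in the triangle i, j, l.
    have := hl (-(r' * r)) (s * s') (by
      rw [neg_smul, mul_smul, ← smul_neg, ← e, mul_smul, smul_comm r' s, ← smul_add, h', smul_zero])
    simpa [hr, hs] using this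
  refine Subtype.ext (Prod.ext hxy (ratios_ext fun i j k hij hik hjk => ?_))
  rw [hp.dd_eq i trivial j trivial k trivial (Or.inl (hpi.ne hij)),
    hq.dd_eq i trivial j trivial k trivial (Or.inl (hqi.ne hij)), hc i j, hc i k,
    hcc i j k hij hik hjk, enorm_smul, enorm_smul, ENNReal.mul_div_mul_left _ _ _ (by simp)]
  have h1 : q i - q k ≠ 0 := sub_ne_zero.2 (hqi.ne hik)
  rw [hc] at h1
  simpa using (smul_ne_zero_iff.1 h1).1

/-- If the largest scale were on a line along v, it would be constant on each `component`, which
depends only on directions and so is a common cluster; a nontrivial one is everything, making the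
scale constant. Once it is off every line, its fibres are common clusters too, hence have one label
each. -/
theorem exists_isTop_injective [Finite ι] [Nontrivial ι] (hxy : x.1.1 = y.1.1)
    (hcl : ∀ A : Set ι, A.Nontrivial → Cluster x A → Cluster y A → A = Set.univ)
    (hline : ¬ ∃ v : V, ‖v‖ = 1 ∧ ∀ i j, i ≠ j → Along v (uu x.1.1 i j)) :
    ∃ p, IsTop x Set.univ p ∧ Function.Injective p ∧ ¬ OnLine p := by
  obtain ⟨p, hp⟩ := exists_isTop x Set.univ Set.finite_univ Set.nontrivial_univ
  have hnl : ¬ OnLine p := by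
    rintro ⟨w, hw⟩
    have hw0 : w ≠ 0 := by
      rintro rfl
      obtain ⟨a⟩ : Nonempty ι := inferInstance
      obtain ⟨b, -, hb⟩ := hp.exists_ne a trivial
      obtain ⟨r, hr⟩ := hw b a
      exact hb (sub_eq_zero.1 (by simpa using hr))
    set v := ‖w‖⁻¹ • w with hvw
    have hv : ‖v‖ = 1 := norm_normalize hw0
    push Not at hline
    obtain ⟨i, j, hij, hna⟩ := hline v hv
    have halong : ∀ a b, p a ≠ p b → Along v (uu x.1.1 a b) := by
      intro a b hab
      obtain ⟨r, hr⟩ := hw a b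
      refine along_of_eq_smul hv (norm_uu _ fun h => hab (h ▸ rfl))
        (r := ‖p a - p b‖⁻¹ * (r * ‖w‖)) ?_
      rw [hp.uu_eq a trivial b trivial hab, mul_smul, mul_smul, hvw, norm_smul_normalize hw0, ← hr]
    have hD : component x v i = Set.univ := by
      refine hcl _ ⟨i, Relation.ReflTransGen.refl, j, Relation.ReflTransGen.single ⟨hij, hna⟩, hij⟩
        (cluster_component x hv i) ?_
      have : component x v i = component y v i := by unfold component; rw [hxy]
      rw [this]; exact cluster_component y hv i
    obtain ⟨b, -, hb⟩ := hp.exists_ne i trivial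
    have hbD : b ∈ component x v i := hD ▸ trivial
    refine hb ?_
    have hbD' : Relation.ReflTransGen _ i b := hbD
    clear hb hbD
    induction hbD' with
    | refl => rfl
    | @tail d e _ hde ih =>
      by_contra hne
      exact hde.2 (halong d e fun h => hne (h.symm.trans ih))
  refine ⟨p, hp, fun i j hij => ?_, hnl⟩
  by_contra hne
  have := hcl {k | p k = p j} ⟨i, hij, j, rfl, hne⟩ (hp.cluster j)
    (hp.cluster_of_dirs_eq hnl hxy j)
  obtain ⟨b, -, hb⟩ := hp.exists_ne j trivial
  have hb' : b ∈ {k | p k = p j} := this ▸ trivial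
  exact hb hb'

theorem along_or_eq [Finite ι] (hxy : x.1.1 = y.1.1)
    (hcl : ∀ A : Set ι, A.Nontrivial → Cluster x A → Cluster y A → A = Set.univ) :
    (∃ v : V, ‖v‖ = 1 ∧ ∀ i j, i ≠ j → Along v (uu x.1.1 i j)) ∨ x = y := by
  rcases subsingleton_or_nontrivial ι with hι | hι
  · exact Or.inr (Subtype.ext (Prod.ext hxy (ratios_ext fun i j k hij =>
      absurd (Subsingleton.elim i j) hij)))
  by_cases hline : ∃ v : V, ‖v‖ = 1 ∧ ∀ i j, i ≠ j → Along v (uu x.1.1 i j)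
  · exact Or.inl hline
  obtain ⟨p, hp, hpi, hpl⟩ := exists_isTop_injective hxy hcl hline
  obtain ⟨q, hq, hqi, -⟩ := exists_isTop_injective hxy.symm
    (fun A h h1 h2 => hcl A h h2 h1) (hxy ▸ hline)
  exact Or.inr (ratios_eq_of_isTop hp hq hpi hqi hpl hxy)

end Directions

/-! ### Points of the line -/

section Line

variable {V : Type} [NormedAddCommGroup V] [NormedSpace ℝ V] {ι : Type}

theorem continuous_conf_sub (i j : ι) : Continuous fun c : Conf V ι => c.1 i - c.1 j :=
  ((continuous_apply i).comp continuous_subtype_val).sub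
    ((continuous_apply j).comp continuous_subtype_val)

theorem continuous_dir : Continuous fun c : Conf V ι => dir c := by
  refine continuous_pi fun p => Continuous.subtype_mk ?_ _
  have h := continuous_conf_sub (V := V) (p 0) (p 1)
  exact (h.norm.inv₀ fun c => norm_ne_zero_iff.2 (conf_sub_ne c (pair_ne p))).smul h

theorem continuous_ratio : Continuous fun c : Conf V ι => ratio c := by
  refine continuous_pi fun t => ENNReal.continuous_ofReal.comp ?_
  have h := fun i j : ι => (continuous_conf_sub (V := V) i j).norm
  exact (h _ _).div (h _ _) fun c => norm_ne_zero_iff.2 (conf_sub_ne c (triple_ne t).2.1)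

/-- The point of `C̃_ι[V]` given by a configuration. -/
def toCBar (c : Conf V ι) : CBar V ι :=
  ⟨(dir c, ratio c), subset_closure ⟨Quotient.mk _ c, rfl⟩⟩

theorem continuous_toCBar : Continuous (toCBar (V := V) (ι := ι)) :=
  (continuous_dir.prodMk continuous_ratio).subtype_mk _

theorem exists_filter_toCBar (x : CBar V ι) :
    ∃ F : Filter (Conf V ι), F.NeBot ∧ Tendsto toCBar F (𝓝 x) := by
  obtain ⟨F, hF, h⟩ := exists_filter x
  exact ⟨F, hF, tendsto_subtype_rng.2 h⟩

theorem finite_sph : Finite (Sph ℝ) := by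
  have : Metric.sphere (0 : ℝ) 1 ⊆ {1, -1} := fun x hx => by
    rw [mem_sphere_zero_iff_norm, Real.norm_eq_abs] at hx
    exact eq_or_eq_neg_of_abs_eq hx
  exact (Set.toFinite _).subset this

instance discreteTopology_sph : DiscreteTopology (Sph ℝ) :=
  have := finite_sph
  inferInstance

/-- Points of `C̃_ι[ℝ]` with the same directions are in the same connected component. -/
theorem connectedComponents_mk_eq [Finite ι] {a b : CBar ℝ ι} (h : a.1.1 = b.1.1) :
    ConnectedComponents.mk a = ConnectedComponents.mk b := by
  -- The configurations with the signs of a form a convex cone. The closure of its image is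
  -- connected and contains every point with these signs, since signs are discrete and thus
  -- eventually constant near such a point.
  let K : Set (ι → ℝ) := {f | ∀ p : C2 ι, 0 < (a.1.1 p).1 * (f (p 0) - f (p 1))}
  have hK : Convex ℝ K := by
    intro f hf g hg s t hs ht hst p
    have h1 := hf p
    have h2 := hg p
    have : (a.1.1 p).1 * ((s • f + t • g) (p 0) - (s • f + t • g) (p 1)) =
        s * ((a.1.1 p).1 * (f (p 0) - f (p 1))) + t * ((a.1.1 p).1 * (g (p 0) - g (p 1))) := by
      simp only [Pi.add_apply, Pi.smul_apply, smul_eq_mul]; ring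
    rw [this]
    rcases hs.eq_or_lt with rfl | hs
    · rw [zero_add] at hst; subst hst; linarith
    · exact add_pos_of_pos_of_nonneg (mul_pos hs h1) (mul_nonneg ht h2.le)
  have hinj : ∀ f ∈ K, Function.Injective f := by
    intro f hf i j hij
    by_contra hne
    simpa [hij] using hf (pair hne)
  have : PreconnectedSpace K := isPreconnected_iff_preconnectedSpace.1 hK.isPreconnected
  let g : K → CBar ℝ ι := fun f => toCBar ⟨f.1, hinj _ f.2⟩
  have hg : Continuous g := continuous_toCBar.comp (by fun_prop)
  have hpre : IsPreconnected (closure (Set.range g)) := (isPreconnected_range hg).closure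
  have key : ∀ z : CBar ℝ ι, z.1.1 = a.1.1 → z ∈ closure (Set.range g) := by
    intro z hz
    obtain ⟨F, hF, hlim⟩ := exists_filter_toCBar z
    have hd : Tendsto dir F (𝓝 a.1.1) := by
      rw [← hz]
      exact ((continuous_fst.comp continuous_subtype_val).tendsto z).comp hlim
    refine mem_closure_of_tendsto hlim ?_
    rw [nhds_discrete, tendsto_pure] at hd
    filter_upwards [hd] with c hc
    refine ⟨⟨c.1, fun p => ?_⟩, rfl⟩
    have hne := conf_sub_ne c (pair_ne p)
    rw [← hc]
    change 0 < (‖c.1 (p 0) - c.1 (p 1)‖⁻¹ * (c.1 (p 0) - c.1 (p 1))) * (c.1 (p 0) - c.1 (p 1))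
    rw [mul_assoc]
    exact mul_pos (inv_pos.2 (norm_pos_iff.2 hne)) (mul_self_pos.2 hne)
  exact ConnectedComponents.coe_eq_coe'.2
    (hpre.subset_connectedComponent (key b h.symm) (key a rfl))

end Line

/-! ### Collinear points -/

section Collinear

variable {V : Type} [NormedAddCommGroup V] [InnerProductSpace ℝ V] {ι : Type}

/-- A point whose directions are all along a line comes from a point of `C̃_ι[ℝ]`. -/
theorem exists_lineMap_eq [Finite ι] (x : CBar V ι) (v : Sph V)
    (h : ∀ i j, i ≠ j → Along v.1 (uu x.1.1 i j)) : ∃ a : CBar ℝ ι, lineMap (v, a) = x := by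
  have hv : ‖v.1‖ = 1 := norm_eq_of_mem_sphere v
  have hvv : inner ℝ v.1 v.1 = (1 : ℝ) := by rw [real_inner_self_eq_norm_sq, hv, one_pow]
  have hu : ∀ p : C2 ι, Along v.1 (x.1.1 p).1 := fun p => by
    rw [← uu_pair]; exact h _ _ (pair_ne p)
  have hσ : ∀ p : C2 ι, ‖inner ℝ v.1 (x.1.1 p).1‖ = (1 : ℝ) := fun p => by
    rcases hu p with h | h <;> simp [h, hv]
  -- The approximating configurations are projected orthogonally to the line of v. Each distance is
  -- multiplied by the absolute value of an inner product tending to ±1, so the signs converge to σ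
  -- and the ratios keep their limits.
  let σ : C2 ι → Sph ℝ := fun p => ⟨inner ℝ v.1 (x.1.1 p).1, by
    rw [mem_sphere_zero_iff_norm]; exact hσ p⟩
  obtain ⟨F, hF, hx⟩ := exists_filter x
  have hin : ∀ p : C2 ι,
      Tendsto (fun c : Conf V ι => (inner ℝ v.1 (dir c p).1 : ℝ)) F (𝓝 (σ p).1) := by
    intro p
    have h1 : Tendsto (fun c : Conf V ι => (dir c p).1) F (𝓝 (x.1.1 p).1) := by
      have := (continuous_fst.tendsto _).comp hx
      exact (continuous_subtype_val.tendsto _).comp ((tendsto_pi_nhds.1 this) p)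
    exact tendsto_const_nhds.inner h1
  have hin' : ∀ (c : Conf V ι) (p : C2 ι), inner ℝ v.1 (c.1 (p 0)) - inner ℝ v.1 (c.1 (p 1)) =
      ‖c.1 (p 0) - c.1 (p 1)‖ * (inner ℝ v.1 (dir c p).1 : ℝ) := by
    intro c p
    rw [← inner_sub_right, ← inner_smul_right]
    congr 1
    exact (norm_smul_normalize (conf_sub_ne c (pair_ne p))).symm
  have hinj : ∀ᶠ c in F, Function.Injective fun i => (inner ℝ v.1 (c.1 i) : ℝ) := by
    have h1 : ∀ᶠ c in F, ∀ p : C2 ι, (inner ℝ v.1 (dir c p).1 : ℝ) ≠ 0 :=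
      eventually_all.2 fun p => (hin p).eventually_ne (norm_ne_zero_iff.1 (by
        rw [hσ p]; exact one_ne_zero))
    filter_upwards [h1] with c hc i j hij
    by_contra hne
    have h2 := hin' c (pair hne)
    have h3 := mul_ne_zero (norm_ne_zero_iff.2 (conf_sub_ne c hne)) (hc (pair hne))
    simp only [pair_zero, pair_one] at h2
    rw [← h2] at h3
    exact h3 (sub_eq_zero.2 hij)
  obtain ⟨c0, hc0⟩ := hinj.exists
  classical
  let c' : Conf V ι → Conf ℝ ι := fun c =>
    if h : Function.Injective fun i => (inner ℝ v.1 (c.1 i) : ℝ) then ⟨_, h⟩ else ⟨_, hc0⟩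
  have hc' : ∀ᶠ c in F, (c' c).1 = fun i => (inner ℝ v.1 (c.1 i) : ℝ) := by
    filter_upwards [hinj] with c hc
    simp [c', hc]
  have hmem : (σ, x.1.2) ∈ cbarSet ℝ ι := by
    rw [cbarSet_eq]
    refine mem_closure_of_tendsto (b := F) (f := fun c => (dir (c' c), ratio (c' c))) ?_
      (Eventually.of_forall fun c => ⟨c' c, rfl⟩)
    refine Tendsto.prodMk_nhds (tendsto_pi_nhds.2 fun p => tendsto_subtype_rng.2 ?_)
      (tendsto_pi_nhds.2 fun t => ?_)
    · have h1 : Tendsto (fun c => (‖(inner ℝ v.1 (dir c p).1 : ℝ)‖⁻¹ • inner ℝ v.1 (dir c p).1 : ℝ))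
          F (𝓝 (‖(σ p).1‖⁻¹ • (σ p).1)) :=
        ((hin p).norm.inv₀ (by rw [hσ p]; exact one_ne_zero)).smul (hin p)
      rw [show ‖(σ p).1‖ = 1 from hσ p, inv_one, one_smul] at h1
      refine h1.congr' ?_
      filter_upwards [hc'] with c hc
      change _ = ‖(c' c).1 (p 0) - (c' c).1 (p 1)‖⁻¹ • ((c' c).1 (p 0) - (c' c).1 (p 1))
      have := norm_ne_zero_iff.2 (conf_sub_ne c (pair_ne p))
      rw [hc, hin', norm_mul, norm_norm, smul_eq_mul, smul_eq_mul, mul_inv]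
      field_simp
    · obtain ⟨h01, h02, h12⟩ := triple_ne t
      have h1 : Tendsto (fun c => ratio c t * (‖(inner ℝ v.1 (dir c (pair h01)).1 : ℝ)‖ₑ /
          ‖(inner ℝ v.1 (dir c (pair h02)).1 : ℝ)‖ₑ)) F (𝓝 (x.1.2 t * 1)) := by
        have e1 : ∀ p, ‖(σ p).1‖ₑ = 1 := fun p => by
          rw [← ofReal_norm, show ‖(σ p).1‖ = 1 from hσ p, ENNReal.ofReal_one]
        have h2 : Tendsto (fun c : Conf V ι => ratio c t) F (𝓝 (x.1.2 t)) :=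
          (tendsto_pi_nhds.1 ((continuous_snd.tendsto _).comp hx)) t
        have h3 := ENNReal.Tendsto.div (hin (pair h01)).enorm (by simp [e1])
          (hin (pair h02)).enorm (by simp [e1])
        rw [e1, e1, ENNReal.div_self one_ne_zero ENNReal.one_ne_top] at h3
        exact ENNReal.Tendsto.mul h2 (by simp) h3 (by simp)
      rw [mul_one] at h1
      refine h1.congr' ?_
      filter_upwards [hc'] with c hc
      have e1 := hin' c (pair h01)
      have e2 := hin' c (pair h02)
      simp only [pair_zero, pair_one] at e1 e2
      rw [← dd_triple (ratio c), ← dd_triple (ratio (c' c)), dd_ratio _ (Or.inl h01),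
        dd_ratio _ (Or.inl h01), hc, e1, e2, enorm_mul, enorm_mul, enorm_norm, enorm_norm]
      rw [ENNReal.mul_div_mul_comm]
      · right; simp
      · left; simp
  refine ⟨⟨_, hmem⟩, Subtype.ext (Prod.ext (funext fun p => Subtype.ext ?_) rfl)⟩
  change (inner ℝ v.1 (x.1.1 p).1 : ℝ) • v.1 = (x.1.1 p).1
  rcases hu p with h | h <;> simp [h, hv]

/-- Both points come from the real line with the same v. Equal directions give equal signs, hence
one component, which is collapsed in R. -/
theorem toR_eq_of_along [Finite ι] {x y : CBar V ι} (hxy : x.1.1 = y.1.1) {v : V} (hv : ‖v‖ = 1)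
    (h : ∀ i j, i ≠ j → Along v (uu x.1.1 i j)) :
    x ∈ collinearSet V ι ∧ y ∈ collinearSet V ι ∧ toR x = toR y := by
  have hv' : v ∈ Metric.sphere (0 : V) 1 := by rwa [mem_sphere_zero_iff_norm]
  obtain ⟨a, rfl⟩ := exists_lineMap_eq x ⟨v, hv'⟩ h
  obtain ⟨b, rfl⟩ := exists_lineMap_eq y ⟨v, hv'⟩ (hxy ▸ h)
  refine ⟨⟨_, rfl⟩, ⟨_, rfl⟩, ?_⟩
  have hab : a.1.1 = b.1.1 := by
    funext p
    have h1 : (a.1.1 p).1 • v = (b.1.1 p).1 • v := congrArg Subtype.val (congrFun hxy p)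
    have hv0 : v ≠ 0 := by rintro rfl; simp at hv
    exact Subtype.ext (smul_left_injective ℝ hv0 h1)
  have e1 : toR (lineMap (⟨v, hv'⟩, a)) = sigmaToR (collapse (⟨v, hv'⟩, a)) :=
    (Quot.sound (RRel.glue (⟨v, hv'⟩, a))).symm
  have e2 : toR (lineMap (⟨v, hv'⟩, b)) = sigmaToR (collapse (⟨v, hv'⟩, b)) :=
    (Quot.sound (RRel.glue (⟨v, hv'⟩, b))).symm
  rw [e1, e2, collapse, collapse, connectedComponents_mk_eq hab]

/-! ### Fibres of the projection to directions -/

variable [FiniteDimensional ℝ V] [Finite ι]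

/-- The tree of common clusters of two points. -/
def commonTree (x y : CBar V ι) : TrunkTree ι where
  vertices := {A | A.Nontrivial ∧ Cluster x A ∧ Cluster y A}
  nontrivial _ h := h.1
  nested _ hA _ hB := hA.2.1.nested hB.2.1
  univ_mem h := ⟨h, cluster_univ x, cluster_univ y⟩

/-- A label outside v sees all of v as a point; a label over v is compared through the chosen
leaves. -/
theorem Cluster.of_vertexCoords {T : TrunkTree ι} {x : CBar V ι}
    (hx : ∀ A ∈ T.vertices, Cluster x A) {v : T.vertices} {A : Set (T.Edges v)}
    (hA : Cluster (vertexCoords T x v) A) : Cluster x {i | ∃ e ∈ A, i ∈ e.1} := by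
  rintro i ⟨e, he, hi⟩ j ⟨f, hf, hj⟩ k hk
  have hiv := T.edge_subset e hi
  have hjv := T.edge_subset f hj
  by_cases hkv : k ∈ v.1
  · have hkA : T.edge v k hkv ∉ A := fun h => hk ⟨_, h, T.mem_edge v hkv⟩
    have ei := T.edge_eq hiv hi
    have ej := T.edge_eq hjv hj
    have hne : T.edge v i hiv ≠ T.edge v k hkv := by
      rw [ei]; intro h; exact hkA (h ▸ he)
    rw [dd_congr_edge hx v hiv hjv hkv (T.leaf_mem v _) (T.leaf_mem v _) (T.leaf_mem v _)
      (Or.inr hne), ← dd_restrict (T.leaf v) x, ei, ej]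
    exact hA e he f hf _ hkA
  · exact hx v.1 v.2 i hiv j hjv k hkv

/-- A fibre of `Q̃` with more than one point lies in some `λ_T` and is collapsed by `q_T`. -/
theorem eq_or_qT_eq {x y : CBar V ι} (hxy : x.1.1 = y.1.1) :
    x = y ∨ ∃ (T : TrunkTree ι) (hx : x ∈ lambdaT V T) (hy : y ∈ lambdaT V T),
      qT T ⟨x, hx⟩ = qT T ⟨y, hy⟩ := by
  set T := commonTree x y with hT
  have hxT : ∀ A ∈ T.vertices, Cluster x A := fun A h => h.2.1
  have hyT : ∀ A ∈ T.vertices, Cluster y A := fun A h => h.2.2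
  have hv : ∀ v : T.vertices, (vertexCoords T x v).1.1 = (vertexCoords T y v).1.1 := by
    intro v
    funext p
    change x.1.1 _ = y.1.1 _
    rw [hxy]
  -- The leaves over a common cluster A of the coordinates form a common cluster of x and y, so a
  -- vertex of T. Unless it is all of v, it lies strictly between v and one of its edges.
  have hcl : ∀ (v : T.vertices) (A : Set (T.Edges v)), A.Nontrivial →
      Cluster (vertexCoords T x v) A → Cluster (vertexCoords T y v) A → A = Set.univ := by
    intro v A hA h1 h2
    obtain ⟨e, he, f, hf, hef⟩ := hA
    set B : Set ι := {i | ∃ e ∈ A, i ∈ e.1}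
    have heB : e.1 ⊂ B := by
      refine ⟨fun i hi => ⟨e, he, hi⟩, fun hsub => ?_⟩
      have : T.leaf v f ∈ e.1 := hsub ⟨f, hf, T.leaf_mem v f⟩
      exact hef (T.edge_eq_of_mem v e f _ this (T.leaf_mem v f))
    have hBT : B ∈ T.vertices := by
      obtain ⟨i, hi⟩ := T.edge_nonempty v e
      obtain ⟨j, hj, hje⟩ := Set.exists_of_ssubset heB
      exact ⟨⟨i, heB.1 hi, j, hj, by rintro rfl; exact hje hi⟩,
        Cluster.of_vertexCoords hxT h1, Cluster.of_vertexCoords hyT h2⟩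
    have hBv : B = v.1 := by
      by_contra hne
      refine e.2.2.2 B hBT ⟨heB, Set.ssubset_iff_subset_ne.2 ⟨?_, hne⟩⟩
      rintro i ⟨g, -, hi⟩
      exact T.edge_subset g hi
    refine Set.eq_univ_of_forall fun g => ?_
    have : T.leaf v g ∈ B := hBv ▸ T.leaf_mem_vertex v g
    obtain ⟨g', hg', h'⟩ := this
    rwa [T.edge_eq_of_mem v g g' _ (T.leaf_mem v g) h']
  have hxs := mem_closedStratum_iff.2 hxT
  have hys := mem_closedStratum_iff.2 hyT
  have key := fun v : T.vertices => along_or_eq (hv v) (hcl v)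
  by_cases hall : ∀ v : T.vertices, vertexCoords T x v = vertexCoords T y v
  · exact Or.inl (eq_of_vertexCoords_eq hxs hys hall)
  right
  push Not at hall
  obtain ⟨v, hvne⟩ := hall
  obtain ⟨w, hw, hw'⟩ := (key v).resolve_right hvne
  obtain ⟨h1, h2, -⟩ := toR_eq_of_along (hv v) hw hw'
  refine ⟨T, ⟨hxs, v, h1⟩, ⟨hys, v, h2⟩, Subtype.ext (funext fun v' => ?_)⟩
  change toR (vertexCoords T x v') = toR (vertexCoords T y v')
  rcases key v' with ⟨w, hw, hw'⟩ | h
  · exact (toR_eq_of_along (hv v') hw hw').2.2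
  · rw [h]

end Collinear

/-! ### A criterion for pushout squares of spaces -/

section Pushout

open CategoryTheory Limits

/-- The condition on fibres makes each cocone constant on the fibres of Q, so it descends along the
quotient map; surjectivity of q gives compatibility on C. -/
theorem isPushout_of_isQuotientMap {A B C D : TopCat.{0}} (i : A ⟶ B) (q : A ⟶ C) (Q : B ⟶ D)
    (h : C ⟶ D) (comm : i ≫ Q = q ≫ h) (hQ : Topology.IsQuotientMap Q) (hq : Function.Surjective q)
    (hfib : ∀ b b', Q b = Q b' → b = b' ∨ ∃ a a', i a = b ∧ i a' = b' ∧ q a = q a') :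
    IsPushout i q Q h := by
  have hepi : ∀ (s : PushoutCocone i q) (b b' : B), Q b = Q b' → s.inl b = s.inl b' := by
    intro s b b' hb
    rcases hfib b b' hb with rfl | ⟨a, a', rfl, rfl, ha⟩
    · rfl
    · have e : ∀ a, s.inl (i a) = s.inr (q a) := fun a =>
        congrArg (fun f : A ⟶ s.pt => f a) s.condition
      rw [e, e, ha]
  let d : ∀ s : PushoutCocone i q, D ⟶ s.pt := fun s =>
    TopCat.ofHom (hQ.lift (f := Q.hom) s.inl.hom (hepi s))
  have hd : ∀ s, Q ≫ d s = s.inl := fun s => by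
    ext b
    exact congrArg (fun f : C(B, s.pt) => f b) (hQ.lift_comp (f := Q.hom) s.inl.hom (hepi s))
  refine ⟨⟨comm⟩, ⟨PushoutCocone.IsColimit.mk comm d hd (fun s => ?_) fun s m hm _ => ?_⟩⟩
  · ext c
    obtain ⟨a, rfl⟩ := hq c
    have e1 : h (q a) = Q (i a) := (congrArg (fun f : A ⟶ D => f a) comm).symm
    have e2 : s.inl (i a) = s.inr (q a) := congrArg (fun f : A ⟶ s.pt => f a) s.condition
    have e3 : d s (Q (i a)) = s.inl (i a) := congrArg (fun f : B ⟶ s.pt => f (i a)) (hd s)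
    change d s (h (q a)) = _
    rw [e1, e3, e2]
  · ext x
    obtain ⟨b, rfl⟩ := hQ.surjective x
    exact congrArg (fun f : B ⟶ s.pt => f b) (hm.trans (hd s).symm)

end Pushout

/-! ### The directions of a point of `R` -/

section Directions

variable {V : Type} [NormedAddCommGroup V] [NormedSpace ℝ V] {ι : Type}

theorem continuous_dirs : Continuous fun x : CBar V ι => x.1.1 :=
  continuous_fst.comp continuous_subtype_val

/-- The signs of the directions at a component of `C̃_ι[ℝ]`. -/
def componentSigns : ConnectedComponents (CBar ℝ ι) → (C2 ι → Sph ℝ) :=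
  (continuous_dirs (V := ℝ)).connectedComponentsLift

theorem continuous_signSmul : Continuous fun z : Sph ℝ × Sph V => signSmul z.1 z.2 := by
  unfold signSmul
  fun_prop

/-- The directions of a point of `R_ι`. -/
def rDir : R V ι → (C2 ι → Sph V) :=
  Quot.lift (Sum.elim (fun s p => signSmul (componentSigns s.2 p) s.1) fun x => x.1.1) (by
    rintro _ _ ⟨w⟩
    rfl)

theorem continuous_rDir : Continuous (rDir (V := V) (ι := ι)) := by
  refine continuous_quot_lift _ (continuous_sumElim.2 ⟨continuous_pi fun p => ?_,
    continuous_dirs⟩)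
  have h : Continuous (componentSigns (ι := ι)) :=
    (continuous_dirs (V := ℝ)).connectedComponentsLift_continuous
  exact continuous_signSmul.comp
    (((continuous_apply p).comp (h.comp continuous_snd)).prodMk continuous_fst)

theorem continuous_toR : Continuous (toR (V := V) (ι := ι)) :=
  continuous_quot_mk.comp continuous_inr

/-- The collinear representatives keep lifted families inside the fat wedge, as surjectivity of `qT`
requires. -/
theorem exists_toR_eq (r : R V ι) :
    ∃ x, toR x = r ∧ (r ∈ Set.range (sigmaToR (V := V) (ι := ι)) → x ∈ collinearSet V ι) := by
  by_cases hr : r ∈ Set.range (sigmaToR (V := V) (ι := ι))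
  · obtain ⟨⟨v, c⟩, rfl⟩ := hr
    obtain ⟨a, rfl⟩ := ConnectedComponents.surjective_coe c
    exact ⟨lineMap (v, a), (Quot.sound (RRel.glue (v, a))).symm, fun _ => ⟨_, rfl⟩⟩
  · obtain ⟨s | x, rfl⟩ := Quot.exists_rep r
    · exact absurd ⟨s, rfl⟩ hr
    · exact ⟨x, rfl, fun h => absurd h hr⟩

theorem continuous_lineMap : Continuous (lineMap (V := V) (ι := ι)) := by
  refine Continuous.subtype_mk (Continuous.prodMk (continuous_pi fun p => ?_) ?_) _
  · exact continuous_signSmul.comp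
      (((continuous_apply p).comp (continuous_dirs.comp continuous_snd)).prodMk continuous_fst)
  · exact continuous_snd.comp (continuous_subtype_val.comp continuous_snd)

theorem continuous_restrictCBar {κ : Type} (σ : κ ↪ ι) :
    Continuous (restrictCBar (V := V) σ) := by
  refine Continuous.subtype_mk ?_ _
  fun_prop

theorem continuous_vertexCoords (T : TrunkTree ι) : Continuous (vertexCoords (V := V) T) :=
  continuous_pi fun _ => continuous_restrictCBar _

theorem continuous_qT (T : TrunkTree ι) : Continuous (qT (V := V) T) :=
  Continuous.subtype_mk (continuous_pi fun v => continuous_toR.comp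
    ((continuous_apply v).comp ((continuous_vertexCoords T).comp continuous_subtype_val))) _

end Directions

/-! ### The maps of the square -/

section Square

variable {V : Type} [NormedAddCommGroup V] [NormedSpace ℝ V] [FiniteDimensional ℝ V] {ι : Type}

instance compactSpace_cbar : CompactSpace (CBar V ι) :=
  isCompact_iff_compactSpace.1 isClosed_closure.isCompact

theorem isClosed_collinearSet : IsClosed (collinearSet V ι) :=
  (isCompact_range continuous_lineMap).isClosed

/-- The range is compact, hence closed, and contains the dense set of configurations. -/
theorem projQ_surjective : Function.Surjective (projQ V ι) := by
  have h : IsClosed (Set.range (projQ V ι)) :=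
    (isCompact_range (projQ V ι).continuous).isClosed
  intro u
  refine (h.closure_subset : closure (Set.range (projQ V ι)) ⊆ _) ?_
  rw [closure_subtype]
  refine closure_mono ?_ u.2
  rintro _ ⟨c, rfl⟩
  exact ⟨⟨dirMod c, subset_closure ⟨c, rfl⟩⟩, ⟨⟨_, subset_closure ⟨c, rfl⟩⟩, rfl⟩, rfl⟩

theorem isQuotientMap_projQ : Topology.IsQuotientMap (projQ V ι) :=
  (projQ V ι).continuous.isClosedMap.isQuotientMap (projQ V ι).continuous projQ_surjective

variable [Finite ι]

instance finite_trunkTree : Finite (TrunkTree ι) :=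
  Finite.of_injective (fun T : TrunkTree ι => T.vertices) fun _ _ h => TrunkTree.ext h

theorem isClosed_lambdaT (T : TrunkTree ι) : IsClosed (lambdaT V T) := by
  refine isClosed_closure.inter (IsClosed.preimage (continuous_vertexCoords T) ?_)
  have : fatWedge (fun v : T.vertices => collinearSet V (T.Edges v)) =
      ⋃ v : T.vertices, (fun z : ∀ v : T.vertices, CBar V (T.Edges v) => z v) ⁻¹'
        collinearSet V (T.Edges v) := by
    ext; simp [fatWedge]
  rw [this]
  exact isClosed_iUnion_of_finite fun v => isClosed_collinearSet.preimage (continuous_apply v)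

/-- There are finitely many trees and the λ_T are closed, so continuity can be checked on each λ_T.
-/
theorem continuous_unionQ : Continuous (unionQ V ι) := by
  refine (locallyFinite_of_finite fun T : TrunkTree ι =>
    (Subtype.val ⁻¹' lambdaT V T : Set (unionLambda V ι))).continuous ?_
    (fun T => (isClosed_lambdaT T).preimage continuous_subtype_val) fun T => ?_
  · ext x
    simpa using Set.mem_iUnion.1 x.2
  · rw [continuousOn_iff_continuous_domRestrict]
    have : Set.domRestrict (Subtype.val ⁻¹' lambdaT V T : Set (unionLambda V ι)) (unionQ V ι) =
        fun x => Quot.mk _ ⟨T, qT T ⟨x.1.1, x.2⟩⟩ := funext fun x => unionQ_eq V ι x.1 T x.2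
    rw [this]
    exact continuous_quot_mk.comp (continuous_sigmaMk.comp ((continuous_qT T).comp (by fun_prop)))

/-- The directions of the point assembled from points of `R` at the vertices of a tree. -/
def glueDir (T : TrunkTree ι) (r : ∀ v : T.vertices, R V (T.Edges v)) : C2 ι → Sph V :=
  fun p => rDir (r (T.join _ (TrunkTree.nontrivial_pair p))) (pair (edge_join_ne T p))

theorem continuous_glueDir (T : TrunkTree ι) : Continuous (glueDir (V := V) T) :=
  continuous_pi fun _ => (continuous_apply _).comp (continuous_rDir.comp (continuous_apply _))

/-- The result does not involve T, so the maps on the various L_T respect the identifications. -/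
theorem glueDir_qT {T : TrunkTree ι} (x : lambdaT V T) : glueDir T (qT T x).1 = x.1.1.1 :=
  congrArg Prod.fst (glue_vertexCoords (mem_closedStratum_iff.1 x.2.1))

theorem qT_surjective (T : TrunkTree ι) : Function.Surjective (qT (V := V) T) := by
  rintro ⟨r, v, hv⟩
  choose z hz hz' using fun v => exists_toR_eq (r v)
  obtain ⟨x, hx, hxz⟩ := exists_vertexCoords_eq T z
  refine ⟨⟨x, hx, v, ?_⟩, Subtype.ext (funext fun w => ?_)⟩
  · rw [hxz]; exact hz' v hv
  · change toR (vertexCoords T x w) = r w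
    rw [hxz, hz]

theorem glueDir_mem {T : TrunkTree ι} (r : LT V T) : glueDir T r.1 ∈ cangleSet V ι := by
  obtain ⟨x, rfl⟩ := qT_surjective T r
  rw [glueDir_qT]
  exact (projQ V ι x.1).2

variable (V ι)

/-- The map `⋃ L_T → C̃_ι⟨V⟩`. -/
def unionDir : C(UnionL V ι, CAngle V ι) where
  toFun := Quot.lift (fun s => ⟨glueDir s.1 s.2.1, glueDir_mem s.2⟩) (by
    rintro _ _ ⟨T, T', x, h, h'⟩
    exact Subtype.ext ((glueDir_qT ⟨x, h⟩).trans (glueDir_qT ⟨x, h'⟩).symm))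
  continuous_toFun := continuous_quot_lift _ (continuous_sigma fun T =>
    ((continuous_glueDir T).comp continuous_subtype_val).subtype_mk _)

variable {V ι}

theorem unionDir_unionQ (x : unionLambda V ι) : unionDir V ι (unionQ V ι x) = projQ V ι x.1 := by
  obtain ⟨T, hT⟩ := Set.mem_iUnion.1 x.2
  rw [unionQ_eq V ι x T hT]
  exact Subtype.ext (glueDir_qT ⟨x.1, hT⟩)

theorem unionQ_surjective : Function.Surjective (unionQ V ι) := by
  intro l
  obtain ⟨⟨T, r⟩, rfl⟩ := Quot.exists_rep l
  obtain ⟨x, rfl⟩ := qT_surjective T r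
  exact ⟨⟨x.1, Set.mem_iUnion.2 ⟨T, x.2⟩⟩, unionQ_eq V ι _ T x.2⟩

end Square

open CategoryTheory in
theorem isPushout_projQ {V : Type} [NormedAddCommGroup V] [InnerProductSpace ℝ V]
    [FiniteDimensional ℝ V] {ι : Type} [Finite ι] :
    IsPushout (TopCat.ofHom (unionIncl V ι)) (TopCat.ofHom ⟨unionQ V ι, continuous_unionQ⟩)
      (TopCat.ofHom (projQ V ι)) (TopCat.ofHom (unionDir V ι)) := by
  refine isPushout_of_isQuotientMap _ _ _ _ ?_ isQuotientMap_projQ unionQ_surjective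
    fun x y hxy => ?_
  · exact TopCat.hom_ext (ContinuousMap.ext fun x => (unionDir_unionQ x).symm)
  · refine (eq_or_qT_eq (x := x) (y := y) (congrArg Subtype.val hxy)).imp_right ?_
    rintro ⟨T, hx, hy, h⟩
    refine ⟨⟨x, Set.mem_iUnion.2 ⟨T, hx⟩⟩, ⟨y, Set.mem_iUnion.2 ⟨T, hy⟩⟩, rfl, rfl, ?_⟩
    change unionQ V ι _ = unionQ V ι _
    rw [unionQ_eq V ι _ T hx, unionQ_eq V ι _ T hy, h]

/-! ### Pushing a compactification into its interior -/

section Selection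

open unitInterval

/-- If a compactification `f : C → X` of a subset `C` of a vector space admits, for `w` near `z`
in `X` and `t > 0`, a notion `P w z t` of closeness of `w` to `z`, which forces `w = z` in the
limit `t = 0` and is convex in `w ∈ C`, then `X` can be deformed into `C`. -/
theorem exists_homotopic_interior {X E : Type*} [TopologicalSpace X] [CompactSpace X] [T2Space X]
    [AddCommGroup E] [Module ℝ E] [TopologicalSpace E] [ContinuousAdd E] [ContinuousSMul ℝ E]
    {C : Set E} (f : C(C, X)) (hf : DenseRange f) (P : X → X → ℝ → Prop)
    (hconv : ∀ z t, Convex ℝ {c | ∃ h : c ∈ C, P (f ⟨c, h⟩) z t})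
    (hopen : ∀ z t, 0 < t → ∀ᶠ a : X × X × ℝ in 𝓝 (z, z, t), P a.1 a.2.1 a.2.2)
    (hsep : ∀ z w, w ≠ z → ∀ᶠ a : X × X × ℝ in 𝓝 (w, z, 0), ¬ P a.1 a.2.1 a.2.2) :
    ∃ s : C(X, C), (∀ x, P (f (s x)) x 1) ∧
      ContinuousMap.Homotopic (ContinuousMap.id X) (f.comp s) := by
  classical
  -- The positive parameter is written as an exponential, so the selection takes place over X × ℝ.
  -- Openness and density supply a configuration that is close throughout a neighbourhood.
  obtain ⟨g, hg⟩ := exists_continuous_forall_mem_convex_of_local_const (X := X × ℝ) (E := E)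
    (t := fun a => {c | ∃ h : c ∈ C, P (f ⟨c, h⟩) a.1 (Real.exp a.2)}) (fun a => hconv _ _) (by
      rintro ⟨x, τ⟩
      have h1 := hopen x (Real.exp τ) (Real.exp_pos τ)
      rw [nhds_prod_eq] at h1
      have h2 := h1.curry
      obtain ⟨c, hc⟩ := hf.exists_mem_open isOpen_interior
        ⟨x, mem_interior_iff_mem_nhds.2 h2⟩
      have h3 := interior_subset hc
      refine ⟨c.1, ?_⟩
      have h4 : Tendsto (fun y : X × ℝ => (y.1, Real.exp y.2)) (𝓝 (x, τ)) (𝓝 (x, Real.exp τ)) :=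
        Continuous.tendsto (by fun_prop) (x, τ)
      filter_upwards [h4.eventually h3] with y hy
      exact ⟨c.2, hy⟩)
  have hgC : ∀ a, g a ∈ C := fun a => (hg a).1
  let G : C(X × ℝ, C) := ⟨fun a => ⟨g a, hgC a⟩, g.continuous.subtype_mk _⟩
  have hG : ∀ a, P (f (G a)) a.1 (Real.exp a.2) := fun a => (hg a).2
  let H : I × X → X := fun a => if 0 < a.1.1 then f (G (a.2, Real.log a.1.1)) else a.2
  have hH : Continuous H := by
    rw [continuous_iff_continuousAt]
    rintro ⟨t, x⟩
    rcases t.2.1.lt_or_eq with ht | ht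
    · have h1 : ContinuousAt (fun a : I × X => f (G (a.2, Real.log a.1.1))) (t, x) := by
        refine (f.continuous.comp G.continuous).continuousAt.comp
          (f := fun a : I × X => (a.2, Real.log a.1.1)) ?_
        refine ContinuousAt.prodMk continuous_snd.continuousAt ?_
        exact ContinuousAt.log (by fun_prop) ht.ne'
      refine h1.congr ?_
      have : ∀ᶠ a : I × X in 𝓝 (t, x), 0 < a.1.1 :=
        (continuous_subtype_val.comp continuous_fst).continuousAt.eventually (lt_mem_nhds ht)
      filter_upwards [this] with a ha
      exact (if_pos ha).symm
    · have hx : H (t, x) = x := if_neg (by rw [← ht]; exact lt_irrefl _)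
      rw [ContinuousAt, hx]
      intro U hU
      -- At time 0, compactness makes the separation uniform: for small t no point outside U is
      -- close to a point near x, so the selected configuration lies in U.
      have hK : IsCompact (interior U)ᶜ := isOpen_interior.isClosed_compl.isCompact
      have h1 : ∀ᶠ b : X × ℝ in 𝓝 (x, 0), ∀ w ∈ (interior U)ᶜ, ¬ P w b.1 b.2 := by
        refine hK.eventually_forall_of_forall_eventually fun w hw => ?_
        have hne : w ≠ x := by
          rintro rfl; exact hw (mem_interior_iff_mem_nhds.2 hU)
        have := hsep x w hne
        have h4 : Tendsto (fun z : (X × ℝ) × X => (z.2, z.1.1, z.1.2)) (𝓝 ((x, 0), w))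
          (𝓝 (w, x, 0)) := Continuous.tendsto (by fun_prop) ((x, (0 : ℝ)), w)
        exact h4.eventually this
      have h2 : Tendsto (fun a : I × X => (a.2, a.1.1)) (𝓝 (t, x)) (𝓝 (x, 0)) := by
        have : Tendsto (fun a : I × X => (a.2, a.1.1)) (𝓝 (t, x)) (𝓝 (x, t.1)) :=
          Continuous.tendsto (by fun_prop) (t, x)
        rwa [← ht] at this
      have h3 : ∀ᶠ a : I × X in 𝓝 (t, x), a.2 ∈ U :=
        (continuous_snd.tendsto (t, x)).eventually hU
      change ∀ᶠ a : I × X in 𝓝 (t, x), H a ∈ U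
      filter_upwards [h2.eventually h1, h3] with a ha ha'
      by_cases hpos : 0 < a.1.1
      · have e : H a = f (G (a.2, Real.log a.1.1)) := if_pos hpos
        have := hG (a.2, Real.log a.1.1)
        rw [Real.exp_log hpos] at this
        rw [e]
        by_contra hcon
        exact ha _ (fun h => hcon (interior_subset h)) this
      · have e : H a = a.2 := if_neg hpos
        rw [e]; exact ha'
  refine ⟨G.comp ⟨fun x => (x, 0), by fun_prop⟩, fun x => ?_, ⟨⟨⟨H, hH⟩, fun x => ?_, fun x => ?_⟩⟩⟩
  · have := hG (x, 0)
    rwa [Real.exp_zero] at this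
  · change (if 0 < ((0 : I) : ℝ) then _ else _) = _
    simp
  · change (if 0 < ((1 : I) : ℝ) then _ else _) = _
    simp

end Selection

/-! ### Closeness of directions and ratios -/

section Close

variable {V : Type} [NormedAddCommGroup V] [InnerProductSpace ℝ V] {ι : Type}

/-- The directions `w` are at small angles to the directions `u`. -/
def CloseDirs (w u : C2 ι → Sph V) (t : ℝ) : Prop :=
  -- The cosine exceeds 1 - t, which is impossible at t = 0; the cutoff at 0 keeps the angles acute
  -- and the condition convex for every t.
  ∀ p, max (1 - t) 0 < inner ℝ (u p).1 (w p).1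

/-- The coordinate `1 / (1 + d)` on `[0, ∞]`. -/
def invCoord (d : ℝ≥0∞) : ℝ := ((1 + d)⁻¹).toReal

theorem continuous_invCoord : Continuous invCoord := by
  refine continuous_iff_continuousAt.2 fun d => ?_
  refine (ENNReal.tendsto_toReal (ENNReal.inv_ne_top.2 (by simp))).comp ?_
  exact (continuous_inv.comp (continuous_const.add (continuous_id (X := ℝ≥0∞)))).continuousAt

theorem invCoord_injective : Function.Injective invCoord := by
  intro d d' h
  have h1 : ∀ d : ℝ≥0∞, (1 + d)⁻¹ ≠ ∞ := fun d => ENNReal.inv_ne_top.2 (by simp)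
  have h2 := inv_injective ((ENNReal.toReal_eq_toReal_iff' (h1 d) (h1 d')).1 h)
  exact (ENNReal.add_right_inj ENNReal.one_ne_top).1 h2

/-- In this coordinate a ratio is a length divided by a sum of lengths, which makes closeness convex
after clearing denominators. -/
theorem invCoord_ofReal_div {a b : ℝ} (ha : 0 ≤ a) (hb : 0 < b) :
    invCoord (ENNReal.ofReal (a / b)) = b / (a + b) := by
  have h : 0 ≤ a / b := div_nonneg ha hb.le
  rw [invCoord, ENNReal.toReal_inv, ENNReal.toReal_add ENNReal.one_ne_top ENNReal.ofReal_ne_top,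
    ENNReal.toReal_ofReal h, ENNReal.toReal_one]
  field_simp
  ring

/-- The pair of labels `(t 0, t 1)`. -/
def fstPair (t : C3 ι) : C2 ι := pair (triple_ne t).1

/-- The pair of labels `(t 0, t 2)`. -/
def sndPair (t : C3 ι) : C2 ι := pair (triple_ne t).2.1

/-- The ratios `d` are close to the ratios `e`, as measured by the components of the directions
`w` along the directions `u`. -/
def CloseRatios (w u : C2 ι → Sph V) (d e : C3 ι → ℝ≥0∞) (ε : ℝ) : Prop :=
  -- For a configuration, multiplication by the sum of the two distances turns each side into an
  -- expression in the components of the differences along u, which are linear. When w = u, the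
  -- inequality says that the coordinates `invCoord` differ by less than ε.
  ∀ t, |inner ℝ (u (sndPair t)).1 (w (sndPair t)).1 * invCoord (d t) - invCoord (e t) *
      (inner ℝ (u (fstPair t)).1 (w (fstPair t)).1 * (1 - invCoord (d t)) +
        inner ℝ (u (sndPair t)).1 (w (sndPair t)).1 * invCoord (d t))| <
    ε * (inner ℝ (u (fstPair t)).1 (w (fstPair t)).1 * (1 - invCoord (d t)) +
        inner ℝ (u (sndPair t)).1 (w (sndPair t)).1 * invCoord (d t))

theorem inner_self_sph (v : Sph V) : inner ℝ v.1 v.1 = (1 : ℝ) := by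
  rw [real_inner_self_eq_norm_sq, norm_eq_of_mem_sphere v, one_pow]

theorem eventually_closeDirs [Finite ι] (u : C2 ι → Sph V) {t : ℝ} (ht : 0 < t) :
    ∀ᶠ a : (C2 ι → Sph V) × (C2 ι → Sph V) × ℝ in 𝓝 (u, u, t), CloseDirs a.1 a.2.1 a.2.2 := by
  refine eventually_all.2 fun p => ?_
  have h1 : Continuous fun a : (C2 ι → Sph V) × (C2 ι → Sph V) × ℝ => max (1 - a.2.2) 0 := by
    fun_prop
  have h2 : Continuous fun a : (C2 ι → Sph V) × (C2 ι → Sph V) × ℝ =>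
      (inner ℝ (a.2.1 p).1 (a.1 p).1 : ℝ) := by fun_prop
  refine h1.continuousAt.eventually_lt h2.continuousAt ?_
  rw [inner_self_sph]
  exact max_lt (by linarith) one_pos

theorem eventually_not_closeDirs {w u : C2 ι → Sph V} (h : w ≠ u) :
    ∀ᶠ a : (C2 ι → Sph V) × (C2 ι → Sph V) × ℝ in 𝓝 (w, u, 0),
      ¬ CloseDirs a.1 a.2.1 a.2.2 := by
  obtain ⟨p, hp⟩ := Function.ne_iff.1 h
  have h1 : Continuous fun a : (C2 ι → Sph V) × (C2 ι → Sph V) × ℝ => max (1 - a.2.2) 0 := by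
    fun_prop
  have h2 : Continuous fun a : (C2 ι → Sph V) × (C2 ι → Sph V) × ℝ =>
      (inner ℝ (a.2.1 p).1 (a.1 p).1 : ℝ) := by fun_prop
  have h3 : (inner ℝ (u p).1 (w p).1 : ℝ) < max (1 - 0) 0 := by
    rw [sub_zero, max_eq_left zero_le_one]
    exact inner_lt_one_iff_real_of_norm_eq_one (norm_eq_of_mem_sphere _) (norm_eq_of_mem_sphere _)
      |>.2 fun e => hp (Subtype.ext e.symm)
  filter_upwards [h2.continuousAt.eventually_lt h1.continuousAt h3] with a ha hc
  exact lt_asymm ha (hc p)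

theorem continuous_closeRatios_left (t : C3 ι) :
    Continuous fun a : CBar V ι × CBar V ι × ℝ =>
      |inner ℝ (a.2.1.1.1 (sndPair t)).1 (a.1.1.1 (sndPair t)).1 * invCoord (a.1.1.2 t) -
        invCoord (a.2.1.1.2 t) *
      (inner ℝ (a.2.1.1.1 (fstPair t)).1 (a.1.1.1 (fstPair t)).1 * (1 - invCoord (a.1.1.2 t)) +
        inner ℝ (a.2.1.1.1 (sndPair t)).1 (a.1.1.1 (sndPair t)).1 * invCoord (a.1.1.2 t))| := by
  have := continuous_invCoord
  fun_prop

theorem continuous_closeRatios_right (t : C3 ι) :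
    Continuous fun a : CBar V ι × CBar V ι × ℝ => a.2.2 *
      (inner ℝ (a.2.1.1.1 (fstPair t)).1 (a.1.1.1 (fstPair t)).1 * (1 - invCoord (a.1.1.2 t)) +
        inner ℝ (a.2.1.1.1 (sndPair t)).1 (a.1.1.1 (sndPair t)).1 * invCoord (a.1.1.2 t)) := by
  have := continuous_invCoord
  fun_prop

theorem eventually_closeRatios [Finite ι] (x : CBar V ι) {ε : ℝ} (hε : 0 < ε) :
    ∀ᶠ a : CBar V ι × CBar V ι × ℝ in 𝓝 (x, x, ε),
      CloseRatios a.1.1.1 a.2.1.1.1 a.1.1.2 a.2.1.1.2 a.2.2 := by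
  refine eventually_all.2 fun t => ?_
  refine (continuous_closeRatios_left t).continuousAt.eventually_lt
    (continuous_closeRatios_right t).continuousAt ?_
  simp only [inner_self_sph, one_mul, sub_add_cancel, mul_one, sub_self, abs_zero]
  exact hε

theorem eventually_not_closeRatios {x y : CBar V ι} (h : y.1.1 = x.1.1) (hne : y ≠ x) :
    ∀ᶠ a : CBar V ι × CBar V ι × ℝ in 𝓝 (y, x, 0),
      ¬ CloseRatios a.1.1.1 a.2.1.1.1 a.1.1.2 a.2.1.1.2 a.2.2 := by
  have hd : y.1.2 ≠ x.1.2 := fun e => hne (Subtype.ext (Prod.ext h e))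
  obtain ⟨t, ht⟩ := Function.ne_iff.1 hd
  filter_upwards [(continuous_closeRatios_right t).continuousAt.eventually_lt
    (continuous_closeRatios_left t).continuousAt (x₀ := (y, x, (0 : ℝ))) (by
      simp only [h, inner_self_sph, one_mul, sub_add_cancel, mul_one]
      exact abs_pos.2 (sub_ne_zero.2 fun e => ht (invCoord_injective e)))] with a ha hc
  exact lt_asymm ha (hc t)

/-! ### Convexity of closeness -/

theorem convex_norm_lt {E F : Type*} [AddCommGroup E] [Module ℝ E] [NormedAddCommGroup F]
    [NormedSpace ℝ F] (L : E →ₗ[ℝ] F) (φ : E →ₗ[ℝ] ℝ) {m : ℝ} (hm : 0 ≤ m) :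
    Convex ℝ {c | m * ‖L c‖ < φ c} := by
  intro x hx y hy a b ha hb hab
  simp only [Set.mem_ofPred_eq, map_add, map_smul, smul_eq_mul] at *
  have h1 : m * ‖a • L x + b • L y‖ ≤ a * (m * ‖L x‖) + b * (m * ‖L y‖) := by
    have := norm_add_le (a • L x) (b • L y)
    rw [norm_smul, norm_smul, Real.norm_of_nonneg ha, Real.norm_of_nonneg hb] at this
    calc _ ≤ m * (a * ‖L x‖ + b * ‖L y‖) := mul_le_mul_of_nonneg_left this hm
      _ = _ := by ring
  rcases ha.eq_or_lt with rfl | ha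
  · rw [zero_add] at hab; subst hab; linarith
  · have h2 := mul_lt_mul_of_pos_left hx ha
    have h3 := mul_le_mul_of_nonneg_left hy.le hb
    linarith

/-- The difference of the positions of the labels of `p`. -/
def diffMap (p : C2 ι) : (ι → V) →ₗ[ℝ] V :=
  LinearMap.proj (R := ℝ) (φ := fun _ => V) (p 0) - LinearMap.proj (R := ℝ) (φ := fun _ => V) (p 1)

/-- The component of `diffMap p` along `u p`. -/
def lengthMap (u : C2 ι → Sph V) (p : C2 ι) : (ι → V) →ₗ[ℝ] ℝ := innerₛₗ ℝ (u p).1 ∘ₗ diffMap p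

theorem lengthMap_eq (u : C2 ι → Sph V) (p : C2 ι) (c : Conf V ι) :
    lengthMap u p c.1 = ‖diffMap p c.1‖ * inner ℝ (u p).1 (dir c p).1 := by
  rw [← inner_smul_right]
  change inner ℝ (u p).1 (c.1 (p 0) - c.1 (p 1)) = _
  congr 1
  exact (norm_smul_normalize (conf_sub_ne c (pair_ne p))).symm

theorem diffMap_norm_pos (p : C2 ι) (c : Conf V ι) : 0 < ‖diffMap p c.1‖ :=
  norm_pos_iff.2 (conf_sub_ne c (pair_ne p))

theorem closeDirs_dir_iff (c : Conf V ι) (u : C2 ι → Sph V) (t : ℝ) :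
    CloseDirs (dir c) u t ↔ ∀ p, max (1 - t) 0 * ‖diffMap p c.1‖ < lengthMap u p c.1 := by
  refine forall_congr' fun p => ?_
  rw [lengthMap_eq, mul_comm, mul_lt_mul_iff_right₀ (diffMap_norm_pos p c)]

theorem invCoord_ratio (c : Conf V ι) (t : C3 ι) :
    invCoord (ratio c t) = ‖diffMap (sndPair t) c.1‖ /
      (‖diffMap (fstPair t) c.1‖ + ‖diffMap (sndPair t) c.1‖) :=
  invCoord_ofReal_div (norm_nonneg _) (diffMap_norm_pos (sndPair t) c)

theorem closeRatios_iff (c : Conf V ι) (u : C2 ι → Sph V) (e : C3 ι → ℝ≥0∞) (ε : ℝ) :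
    CloseRatios (dir c) u (ratio c) e ε ↔ ∀ t,
      1 * ‖(lengthMap u (sndPair t) - invCoord (e t) •
        (lengthMap u (fstPair t) + lengthMap u (sndPair t))) c.1‖ <
      (ε • (lengthMap u (fstPair t) + lengthMap u (sndPair t))) c.1 := by
  refine forall_congr' fun t => ?_
  simp only [LinearMap.sub_apply, LinearMap.smul_apply, LinearMap.add_apply, lengthMap_eq,
    smul_eq_mul, one_mul, Real.norm_eq_abs]
  rw [invCoord_ratio]
  have ha := diffMap_norm_pos (fstPair t) c
  have hb := diffMap_norm_pos (sndPair t) c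
  generalize ‖diffMap (fstPair t) c.1‖ = a at *
  generalize ‖diffMap (sndPair t) c.1‖ = b at *
  generalize (inner ℝ (u (fstPair t)).1 (dir c (fstPair t)).1 : ℝ) = α
  generalize (inner ℝ (u (sndPair t)).1 (dir c (sndPair t)).1 : ℝ) = β
  generalize invCoord (e t) = k
  have hab : 0 < a + b := add_pos ha hb
  have e1 : β * (b / (a + b)) = (b * β) / (a + b) := by ring
  have e2 : α * (1 - b / (a + b)) + β * (b / (a + b)) = (a * α + b * β) / (a + b) := by
    field_simp
    ring
  rw [e2, e1, ← mul_div_assoc, ← sub_div, abs_div, abs_of_pos hab, ← mul_div_assoc,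
    div_lt_div_iff_of_pos_right hab]

theorem injective_of_lengthMap_pos {u : C2 ι → Sph V} {c : ι → V} {m : ℝ}
    (h : ∀ p, m * ‖diffMap p c‖ < lengthMap u p c) : Function.Injective c := by
  intro i j hij
  by_contra hne
  have h1 := h (pair hne)
  have h2 : diffMap (pair hne) c = 0 := sub_eq_zero.2 hij
  have h3 : lengthMap u (pair hne) c = 0 := by
    change inner ℝ _ (diffMap (pair hne) c) = _
    rw [h2, inner_zero_right]
  rw [h2, h3] at h1
  simp at h1

theorem convex_closeDirs (u : C2 ι → Sph V) (t : ℝ) :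
    Convex ℝ {c : ι → V | ∃ h : c ∈ {x | Function.Injective x}, CloseDirs (dir ⟨c, h⟩) u t} := by
  have : {c : ι → V | ∃ h : c ∈ {x | Function.Injective x}, CloseDirs (dir ⟨c, h⟩) u t} =
      ⋂ p, {c | max (1 - t) 0 * ‖diffMap p c‖ < lengthMap u p c} := by
    ext c
    simp only [closeDirs_dir_iff, Set.mem_iInter, Set.mem_ofPred_eq]
    exact ⟨fun ⟨_, h⟩ => h, fun h => ⟨injective_of_lengthMap_pos h, h⟩⟩
  rw [this]
  exact convex_iInter fun p => convex_norm_lt _ _ (le_max_right _ _)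

theorem convex_closeRatios (u : C2 ι → Sph V) (e : C3 ι → ℝ≥0∞) (t : ℝ) :
    Convex ℝ {c : ι → V | ∃ h : c ∈ {x | Function.Injective x},
      CloseDirs (dir ⟨c, h⟩) u t ∧ CloseRatios (dir ⟨c, h⟩) u (ratio ⟨c, h⟩) e t} := by
  have : {c : ι → V | ∃ h : c ∈ {x | Function.Injective x},
      CloseDirs (dir ⟨c, h⟩) u t ∧ CloseRatios (dir ⟨c, h⟩) u (ratio ⟨c, h⟩) e t} =
      {c : ι → V | ∃ h : c ∈ {x | Function.Injective x}, CloseDirs (dir ⟨c, h⟩) u t} ∩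
      ⋂ s, {c | 1 * ‖(lengthMap u (sndPair s) - invCoord (e s) •
        (lengthMap u (fstPair s) + lengthMap u (sndPair s))) c‖ <
      (t • (lengthMap u (fstPair s) + lengthMap u (sndPair s))) c} := by
    ext c
    simp only [closeRatios_iff, Set.mem_inter_iff, Set.mem_iInter, Set.mem_ofPred_eq]
    exact ⟨fun ⟨h, h1, h2⟩ => ⟨⟨h, h1⟩, h2⟩, fun ⟨⟨h, h1⟩, h2⟩ => ⟨h, h1, h2⟩⟩
  rw [this]
  exact (convex_closeDirs u t).inter (convex_iInter fun s => convex_norm_lt _ _ zero_le_one)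

end Close

/-! ### The homotopy equivalence -/

section HomotopyEquivalence

variable {V : Type} [NormedAddCommGroup V] [InnerProductSpace ℝ V] [FiniteDimensional ℝ V]
  {ι : Type} [Finite ι]

instance compactSpace_cangle : CompactSpace (CAngle V ι) :=
  isCompact_iff_compactSpace.1 isClosed_closure.isCompact

/-- The point of `C̃_ι⟨V⟩` given by a configuration. -/
def toCAngle (c : Conf V ι) : CAngle V ι := ⟨dir c, subset_closure ⟨Quotient.mk _ c, rfl⟩⟩

theorem continuous_toCAngle : Continuous (toCAngle (V := V) (ι := ι)) :=
  continuous_dir.subtype_mk _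

theorem denseRange_toCAngle : DenseRange (toCAngle (V := V) (ι := ι)) := by
  intro u
  rw [closure_subtype]
  have h : u.1 ∈ closure (Set.range fun c : Conf V ι => dir c) :=
    cangleSet_eq (V := V) (ι := ι) ▸ u.2
  refine closure_mono ?_ h
  rintro _ ⟨c, rfl⟩
  exact ⟨_, ⟨c, rfl⟩, rfl⟩

theorem denseRange_toCBar : DenseRange (toCBar (V := V) (ι := ι)) := by
  intro x
  obtain ⟨F, hF, h⟩ := exists_filter_toCBar x
  exact mem_closure_of_tendsto h (Eventually.of_forall fun c => ⟨c, rfl⟩)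

theorem exists_cangle_homotopic_interior :
    ∃ s : C(CAngle V ι, Conf V ι), (∀ u, CloseDirs (dir (s u)) u.1 1) ∧
      ContinuousMap.Homotopic (ContinuousMap.id _)
        ((⟨toCAngle, continuous_toCAngle⟩ : C(Conf V ι, CAngle V ι)).comp s) := by
  refine exists_homotopic_interior (C := {x : ι → V | Function.Injective x})
    ⟨toCAngle, continuous_toCAngle⟩ denseRange_toCAngle (fun w u t => CloseDirs w.1 u.1 t)
    (fun u t => convex_closeDirs u.1 t) (fun u t ht => ?_) fun u w hne => ?_
  · have h : Tendsto (fun a : CAngle V ι × CAngle V ι × ℝ => (a.1.1, a.2.1.1, a.2.2))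
      (𝓝 (u, u, t)) (𝓝 (u.1, u.1, t)) := Continuous.tendsto (by fun_prop) (u, u, t)
    exact h.eventually (eventually_closeDirs u.1 ht)
  · have h : Tendsto (fun a : CAngle V ι × CAngle V ι × ℝ => (a.1.1, a.2.1.1, a.2.2))
      (𝓝 (w, u, 0)) (𝓝 (w.1, u.1, 0)) := Continuous.tendsto (by fun_prop) (w, u, (0 : ℝ))
    exact h.eventually (eventually_not_closeDirs fun e => hne (Subtype.ext e))

theorem exists_cbar_homotopic_interior :
    ∃ s : C(CBar V ι, Conf V ι), (∀ x, CloseDirs (dir (s x)) x.1.1 1) ∧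
      ContinuousMap.Homotopic (ContinuousMap.id _)
        ((⟨toCBar, continuous_toCBar⟩ : C(Conf V ι, CBar V ι)).comp s) := by
  refine (exists_homotopic_interior (C := {x : ι → V | Function.Injective x})
    ⟨toCBar, continuous_toCBar⟩ denseRange_toCBar
    (fun w x t => CloseDirs w.1.1 x.1.1 t ∧ CloseRatios w.1.1 x.1.1 w.1.2 x.1.2 t)
    (fun x t => convex_closeRatios x.1.1 x.1.2 t) (fun x t ht => ?_) fun x w hne => ?_).imp
      fun s hs => ⟨fun x => (hs.1 x).1, hs.2⟩
  · have h : Tendsto (fun a : CBar V ι × CBar V ι × ℝ => (a.1.1.1, a.2.1.1.1, a.2.2))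
      (𝓝 (x, x, t)) (𝓝 (x.1.1, x.1.1, t)) := Continuous.tendsto (by fun_prop) (x, x, t)
    exact (h.eventually (eventually_closeDirs x.1.1 ht)).and (eventually_closeRatios x ht)
  -- Different directions already violate closeness of directions; with equal directions the ratios
  -- must differ and separate the points.
  · by_cases hd : w.1.1 = x.1.1
    · filter_upwards [eventually_not_closeRatios hd hne] with a ha h
      exact ha h.2
    · have h : Tendsto (fun a : CBar V ι × CBar V ι × ℝ => (a.1.1.1, a.2.1.1.1, a.2.2))
        (𝓝 (w, x, 0)) (𝓝 (w.1.1, x.1.1, 0)) := Continuous.tendsto (by fun_prop) (w, x, (0 : ℝ))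
      filter_upwards [h.eventually (eventually_not_closeDirs hd)] with a ha h
      exact ha h.1

/-- Two families of configurations with directions close to those of `x` are joined by segments. -/
theorem homotopic_of_closeDirs (s s' : C(CBar V ι, Conf V ι))
    (hs : ∀ x, CloseDirs (dir (s x)) x.1.1 1) (hs' : ∀ x, CloseDirs (dir (s' x)) x.1.1 1) :
    ContinuousMap.Homotopic s s' := by
  have h : ∀ a : unitInterval × CBar V ι,
      Function.Injective ((1 - a.1.1) • (s a.2).1 + a.1.1 • (s' a.2).1) := by
    intro a
    obtain ⟨h, -⟩ := convex_closeDirs a.2.1.1 1 ⟨(s a.2).2, hs a.2⟩ ⟨(s' a.2).2, hs' a.2⟩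
      (sub_nonneg.2 a.1.2.2) a.1.2.1 (sub_add_cancel 1 a.1.1)
    exact h
  refine ⟨⟨⟨fun a => ⟨_, h a⟩, ?_⟩, fun x => Subtype.ext ?_, fun x => Subtype.ext ?_⟩⟩
  · refine Continuous.subtype_mk ?_ _
    have h1 : Continuous fun a : unitInterval × CBar V ι => (s a.2).1 :=
      continuous_subtype_val.comp (s.continuous.comp continuous_snd)
    have h2 : Continuous fun a : unitInterval × CBar V ι => (s' a.2).1 :=
      continuous_subtype_val.comp (s'.continuous.comp continuous_snd)
    fun_prop
  · simp
  · simp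

/-- On the target, the projection after the inverse is the deformation into configurations; on the
domain, the inverse after the projection is compared with the deformation through r. -/
theorem exists_homotopyEquiv_projQ :
    ∃ e : ContinuousMap.HomotopyEquiv (CBar V ι) (CAngle V ι), e.toFun = projQ V ι := by
  obtain ⟨s, hs, hsh⟩ := exists_cangle_homotopic_interior (V := V) (ι := ι)
  obtain ⟨r, hr, hrh⟩ := exists_cbar_homotopic_interior (V := V) (ι := ι)
  let i : C(Conf V ι, CBar V ι) := ⟨toCBar, continuous_toCBar⟩
  have h : ContinuousMap.Homotopic r (s.comp (projQ V ι)) :=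
    homotopic_of_closeDirs r _ hr fun x => hs (projQ V ι x)
  refine ⟨⟨projQ V ι, i.comp s, ?_, hsh.symm⟩, rfl⟩
  exact (hrh.trans ((ContinuousMap.Homotopic.refl i).comp h)).symm

end HomotopyEquivalence

end ConfigSpace

end

open CategoryTheory ConfigSpace in
theorem mainTheorem9 (m n : ℕ) :
    (∃ (hq : Continuous (unionQ (EuclideanSpace ℝ (Fin m)) (Fin n)))
      (h : C(UnionL (EuclideanSpace ℝ (Fin m)) (Fin n),
        CAngle (EuclideanSpace ℝ (Fin m)) (Fin n))),
      IsPushout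
        (TopCat.ofHom (unionIncl (EuclideanSpace ℝ (Fin m)) (Fin n)))
        (TopCat.ofHom ⟨unionQ (EuclideanSpace ℝ (Fin m)) (Fin n), hq⟩)
        (TopCat.ofHom (projQ (EuclideanSpace ℝ (Fin m)) (Fin n)))
        (TopCat.ofHom h)) ∧
    ∃ e : ContinuousMap.HomotopyEquiv (CBar (EuclideanSpace ℝ (Fin m)) (Fin n))
        (CAngle (EuclideanSpace ℝ (Fin m)) (Fin n)),
      e.toFun = projQ (EuclideanSpace ℝ (Fin m)) (Fin n) :=
  ⟨⟨continuous_unionQ, unionDir _ _, isPushout_projQ⟩, exists_homotopyEquiv_projQ⟩
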